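/- **Setting.** A *hybrid automaton* $\mathcal H$ (with trivial invariants) has finitely many locations, real variables $x_1,\dots,x_d$ (states $\sigma=(\ell,\nu)$ with $\nu\in\mathbb R^d$), a vector field for each location, a finite set of jumps $e=(\ell,g,r,\ell')$ (source, guard $g\subseteq\mathbb R^d$, reset $r:\mathbb R^d\to\mathbb R^d$, target) and one initial state. The jump $e$ is enabled in $(\ell,\nu)$ if $\nu\in g$, and leads to $(\ell',r(\nu))$. From each state every delay $t\ge 0$ leads along the flow to exactly one state; flows, guards and resets are Borel measurable. A *path* alternates delays and jumps; a *trace* $(\sigma_0,e_0,\dots,e_n)$ is the first state of a path with the sequence of its jumps; it is *initial* if $\sigma_0$ is the initial state. *Composed scheduling* $\mathcal C$. Add to each location $\ell$ a resampling jump $(\ell,g,\mathrm{id},\ell)$ whose guard $g$ is the complement of the union of the guards of the given jumps from $\ell$. There are a stochastic kernel $\Psi_c$ from states to $\mathbb R_{\ge0}$ with absolutely continuous values and a stochastic kernel $\Psi_d$ from states to jumps, supported on the enabled jumps. Put $\Pr_{\mathcal C}(\sigma_0)=1$ and $$\Pr_{\mathcal C}(\sigma_0,e_0,\dots,e_n)=\int_{\{t\,:\,e_0\text{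 enabled in }\sigma_0^t\}}\Psi_d(\sigma_0^t)(e_0)\,\Pr_{\mathcal C}(\sigma_1,e_1,\dots,e_n)\,\Psi_c(\sigma_0)(dt),$$ where $\sigma_0^t$ is the state reached after time $t$ and $\sigma_1$ its successor under $e_0$. *Decomposed scheduling* $\mathcal D$. There are $k\ge1$ independent random variables $X_1,\dots,X_k$; the law of $X_i$ is an absolutely continuous law on $\mathbb R_{\ge 0}$ that depends measurably on the state in which $X_i$ is sampled. Each given jump carries one of them as its label, and two different jumps with the same label are never enabled simultaneously. For each location $\ell$ and each $i$ add a resampling jump $(\ell,g,\mathrm{id},\ell)$ with label $i$, whose guard is the complement of the union of the guards of the given jumps from $\ell$ with label $i$. All $X_i$ are sampled in the first state; time passes until the smallest remaining time is $0$; an enabled jump whose random variable has remaining time $0$ is taken; that random variable is sampled anew in the successor state and the others keep their remaining times; and so on. $\Pr_{\mathcal D}(\tau)$ is the probability that the jumps of the trace $\tau$ are taken in this way. *Pr-equivalence.* The locations and some of the variables ("shared variables") of $\mathcal D$ are identified with locations and variables of $\mathcal C$, and jumps of $\mathcal D$ with jumps of $\mathcal C$; the other variables are auxiliary. Identified jumps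 that occur in initial traces must be the same tuple on locations and shared variables, with guards, and effects on the shared variables, that depend only on the shared variables. $\mathcal D$ and $\mathcal C$ are *Pr-equivalent* under the identification if * along initial paths of $\mathcal D$, equal delays and identified jumps lead to states that agree in location and shared variables (in particular the initial states agree); * the sets of initial traces are equal under the identification; * each initial trace has the same probability in $\mathcal D$ and $\mathcal C$ (if several traces of $\mathcal D$ are identified with the same trace of $\mathcal C$, their probabilities are added); * at the start of each initial trace and of each of its sub-traces, i.e. after each initial path of $\mathcal D$, the next delay has the same distribution function in $\mathcal D$ and $\mathcal C$. In $\mathcal C$ its law is $\Psi_c(\sigma)$, where $\sigma$ is the state reached. In $\mathcal D$ it is the law of the minimum of the independent remaining times, where the remaining time of $X_i$, last sampled in the state $s_i$ a time $r_i$ ago, has the law of $X_i-r_i$ given $X_i>r_i$, with $X_i$ sampled in $s_i$. Only paths are considered along which, at each jump, $\Pr(X_i>\text{age of }X_i)>0$ for all $i$. **Theorem.** 1. For every hybrid automaton $\mathcal D$ with decomposed scheduling there are a hybrid automaton $\mathcal C$ with composed scheduling and an identification under which they are Pr-equivalent. Here the identification can be chosen one-to-one on locations and on jumps and such that all variables of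 $\mathcal D$ are shared (so only $\mathcal C$ has auxiliary variables). 2. There is a hybrid automaton $\mathcal C'$ with composed scheduling such that no hybrid automaton $\mathcal D'$ with decomposed scheduling is Pr-equivalent to $\mathcal C'$ under any identification. $\mathcal C'$ can be chosen such that in its initial state the delay is uniformly distributed on $(0,10)$ and that, after any delay from the initial state, two distinct non-resampling jumps are chosen with probabilities $0.25$ and $0.75$. -/

import Mathlib

open MeasureTheory ProbabilityTheory Set
open scoped NNReal ENNReal

/-- Lebesgue measure on the nonnegative reals. -/
noncomputable def lebesgueNN : Measure ℝ≥0 :=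
  (volume : Measure ℝ).comap ((↑) : ℝ≥0 → ℝ)

/-- States `(ℓ, ν)` over the locations `Fin n` and the variables `Fin d`. -/
abbrev HState (n d : ℕ) : Type := Fin n × (Fin d → ℝ)

/-- A hybrid automaton with trivial invariants and one initial state. Its jumps are listed by the
index type `E`; jump `e` is the tuple `(source e, guard e, reset e, target e)`. -/
structure HybridAutomaton (n d : ℕ) (E : Type) where
  flow : Fin n → (Fin d → ℝ) → (Fin d → ℝ)
  source : E → Fin n
  guard : E → Set (Fin d → ℝ)
  reset : E → (Fin d → ℝ) → (Fin d → ℝ)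
  target : E → Fin n
  init : HState n d

/-- The time step `(ℓ, ν) →[t] (ℓ, ν')` for the vector field `F` of the location `ℓ`. -/
def TimeStep {d : ℕ} (F : (Fin d → ℝ) → (Fin d → ℝ)) (ν : Fin d → ℝ) (t : ℝ≥0)
    (ν' : Fin d → ℝ) : Prop :=
  ∃ f : ℝ → (Fin d → ℝ), ContinuousOn f (Icc 0 (t : ℝ)) ∧ f 0 = ν ∧ f (t : ℝ) = ν' ∧
    ∀ s ∈ Ioo (0 : ℝ) (t : ℝ), HasDerivAt f (F (f s)) s

/-- The valuation reached from `ν` after time `t` (meaningful when it is unique). -/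
noncomputable def evolveVal {d : ℕ} (F : (Fin d → ℝ) → (Fin d → ℝ)) (ν : Fin d → ℝ) (t : ℝ≥0) :
    Fin d → ℝ :=
  Classical.epsilon (fun ν' => TimeStep F ν t ν')

namespace HybridAutomaton

variable {n d : ℕ} {E : Type}

/-- The state reached from `σ` by letting time `t` pass. -/
noncomputable def evolve (H : HybridAutomaton n d E) (σ : HState n d) (t : ℝ≥0) : HState n d :=
  (σ.1, evolveVal (H.flow σ.1) σ.2 t)

/-- The jump `e` is enabled in `σ`. -/
def Enabled (H : HybridAutomaton n d E) (e : E) (σ : HState n d) : Prop :=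
  H.source e = σ.1 ∧ σ.2 ∈ H.guard e

/-- The successor of `σ` under the jump `e`. -/
def after (H : HybridAutomaton n d E) (e : E) (σ : HState n d) : HState n d :=
  (H.target e, H.reset e σ.2)

/-- Standing assumptions: from every state, every delay leads to exactly one state, and flows,
guards and resets are Borel measurable. -/
structure WellPosed (H : HybridAutomaton n d E) : Prop where
  existsUnique_timeStep : ∀ ℓ ν (t : ℝ≥0), ∃! ν', TimeStep (H.flow ℓ) ν t ν'
  measurable_evolve : ∀ ℓ,
    Measurable (fun p : (Fin d → ℝ) × ℝ≥0 => evolveVal (H.flow ℓ) p.1 p.2)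
  measurableSet_guard : ∀ e, MeasurableSet (H.guard e)
  measurable_reset : ∀ e, Measurable (H.reset e)

/-- The jumps form a set of tuples: different indices give different tuples. -/
def JumpsDistinct (H : HybridAutomaton n d E) : Prop :=
  Function.Injective (fun e => (H.source e, H.guard e, H.reset e, H.target e))

/-- `IsPath σ [(t₀, e₀), (t₁, e₁), …]`: the alternation of delays `tᵢ` and jumps `eᵢ` is a finite
path from `σ`. -/
def IsPath (H : HybridAutomaton n d E) : HState n d → List (ℝ≥0 × E) → Prop
  | _, [] => True
  | σ, (t, e) :: h => H.Enabled e (H.evolve σ t) ∧ H.IsPath (H.after e (H.evolve σ t)) h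

/-- The last state of a path from `σ`. -/
noncomputable def run (H : HybridAutomaton n d E) : HState n d → List (ℝ≥0 × E) → HState n d
  | σ, [] => σ
  | σ, (t, e) :: h => H.run (H.after e (H.evolve σ t)) h

/-- `(σ, e₀, …, eₙ)` is a trace: the jumps `e₀, …, eₙ` are those of some path from `σ`. -/
def IsTrace (H : HybridAutomaton n d E) (σ : HState n d) (τ : List E) : Prop :=
  ∃ h, H.IsPath σ h ∧ h.map Prod.snd = τ

/-- The jump `e` occurs in some initial trace. -/
def Live (H : HybridAutomaton n d E) (e : E) : Prop :=
  ∃ τ, H.IsTrace H.init τ ∧ e ∈ τ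

/-- The composed resampling extension: each location `ℓ` gets the jump `Sum.inr ℓ` from `ℓ` to `ℓ`
with identity reset, enabled exactly when no jump of the given automaton is. -/
def composedExtension (H : HybridAutomaton n d E) : HybridAutomaton n d (E ⊕ Fin n) where
  flow := H.flow
  source := Sum.elim H.source id
  guard := Sum.elim H.guard (fun ℓ => (⋃ e ∈ {e | H.source e = ℓ}, H.guard e)ᶜ)
  reset := Sum.elim H.reset (fun _ => id)
  target := Sum.elim H.target id
  init := H.init

/-- The decomposed resampling extension for a labelling `a` of the jumps by `k` random variables:
each location `ℓ` and each `i` get the jump `Sum.inr (ℓ, i)` from `ℓ` to `ℓ` with identity reset,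
enabled exactly when no jump labelled `i` of the given automaton is. -/
def decomposedExtension {k : ℕ} (H : HybridAutomaton n d E) (a : E → Fin k) :
    HybridAutomaton n d (E ⊕ (Fin n × Fin k)) where
  flow := H.flow
  source := Sum.elim H.source Prod.fst
  guard := Sum.elim H.guard
    (fun p => (⋃ e ∈ {e | H.source e = p.1 ∧ a e = p.2}, H.guard e)ᶜ)
  reset := Sum.elim H.reset (fun _ => id)
  target := Sum.elim H.target Prod.fst
  init := H.init

end HybridAutomaton

/-- A hybrid automaton with composed scheduling, with `n` locations, `d` variables and `m` jumps
besides the resampling jumps: a continuous delay kernel and a jump kernel. -/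
structure ComposedHA (n d m : ℕ) where
  base : HybridAutomaton n d (Fin m)
  wellPosed : base.WellPosed
  jumpsDistinct : base.JumpsDistinct
  delay : Kernel (HState n d) ℝ≥0
  isMarkovKernel_delay : IsMarkovKernel delay
  delay_absolutelyContinuous : ∀ σ, delay σ ≪ lebesgueNN
  choice : Kernel (HState n d) (Fin m ⊕ Fin n)
  isMarkovKernel_choice : IsMarkovKernel choice
  choice_eq_zero : ∀ σ e, ¬ base.composedExtension.Enabled e σ → choice σ {e} = 0

namespace ComposedHA

variable {n d m : ℕ}

/-- The underlying hybrid automaton, with the resampling jumps. -/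
def automaton (C : ComposedHA n d m) : HybridAutomaton n d (Fin m ⊕ Fin n) :=
  C.base.composedExtension

/-- The probability of the trace `(σ, e₀, …, eₙ)`. -/
noncomputable def pr (C : ComposedHA n d m) : HState n d → List (Fin m ⊕ Fin n) → ℝ≥0∞
  | _, [] => 1
  | σ, e :: τ =>
      ∫⁻ t in {t : ℝ≥0 | C.automaton.Enabled e (C.automaton.evolve σ t)},
        C.choice (C.automaton.evolve σ t) {e} *
          C.pr (C.automaton.after e (C.automaton.evolve σ t)) τ ∂(C.delay σ)

end ComposedHA

/-- A hybrid automaton with decomposed scheduling, with `n` locations, `d` variables, `m` jumps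
besides the resampling jumps, and `k` independent continuous random variables; `dist i σ` is the
law from which the `i`-th one is sampled in the state `σ`. -/
structure DecomposedHA (n d m k : ℕ) where
  base : HybridAutomaton n d (Fin m)
  wellPosed : base.WellPosed
  jumpsDistinct : base.JumpsDistinct
  k_pos : 0 < k
  baseLabel : Fin m → Fin k
  not_both_enabled : ∀ e e', e ≠ e' → baseLabel e = baseLabel e' →
    ∀ σ, ¬ (base.Enabled e σ ∧ base.Enabled e' σ)
  dist : Fin k → Kernel (HState n d) ℝ≥0
  isMarkovKernel_dist : ∀ i, IsMarkovKernel (dist i)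
  dist_absolutelyContinuous : ∀ i σ, dist i σ ≪ lebesgueNN

namespace DecomposedHA

variable {n d m k : ℕ}

/-- The underlying hybrid automaton, with the resampling jumps. -/
def automaton (D : DecomposedHA n d m k) : HybridAutomaton n d (Fin m ⊕ (Fin n × Fin k)) :=
  D.base.decomposedExtension D.baseLabel

/-- The random variable attached to a jump. -/
def label (D : DecomposedHA n d m k) : Fin m ⊕ (Fin n × Fin k) → Fin k :=
  Sum.elim D.baseLabel Prod.snd

open Classical in
/-- The probability of taking the jumps `e₀, …, eₙ` next, when the current state is `σ` and
the remaining times of the random variables are `R`. -/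
noncomputable def prFrom (D : DecomposedHA n d m k) :
    HState n d → (Fin k → ℝ≥0) → List (Fin m ⊕ (Fin n × Fin k)) → ℝ≥0∞
  | _, _, [] => 1
  | σ, R, e :: τ =>
      if D.automaton.Enabled e σ ∧ R (D.label e) = 0 then
        ∫⁻ x, D.prFrom
            (D.automaton.evolve (D.automaton.after e σ)
              (⨅ j, Function.update R (D.label e) x j))
            (fun i => Function.update R (D.label e) x i -
              ⨅ j, Function.update R (D.label e) x j) τ
          ∂(D.dist (D.label e) (D.automaton.after e σ))
      else 0

/-- The probability of the trace `(σ, e₀, …, eₙ)`: all random variables are sampled in `σ`, and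
the first jump is due after the smallest of the sampled times. -/
noncomputable def pr (D : DecomposedHA n d m k) (σ : HState n d)
    (τ : List (Fin m ⊕ (Fin n × Fin k))) : ℝ≥0∞ :=
  ∫⁻ x : Fin k → ℝ≥0, D.prFrom (D.automaton.evolve σ (⨅ j, x j)) (fun i => x i - ⨅ j, x j) τ
    ∂(Measure.pi (fun i => D.dist i σ))

/-- For each random variable, the state in which it was last sampled and the time since then. -/
abbrev Memory (n d k : ℕ) : Type := Fin k → HState n d × ℝ≥0

/-- The memory after a delay `t` and a jump `e` into the state `σ`: the random variable of `e` is
sampled anew in `σ`, the others have aged by `t`. -/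
noncomputable def updateMemory (D : DecomposedHA n d m k) (M : Memory n d k) (t : ℝ≥0)
    (e : Fin m ⊕ (Fin n × Fin k)) (σ : HState n d) : Memory n d k :=
  Function.update (fun i => ((M i).1, (M i).2 + t)) (D.label e) (σ, 0)

/-- The memory after a path that starts in `σ` with memory `M`. -/
noncomputable def memory (D : DecomposedHA n d m k) :
    HState n d → Memory n d k → List (ℝ≥0 × (Fin m ⊕ (Fin n × Fin k))) → Memory n d k
  | _, M, [] => M
  | σ, M, (t, e) :: h =>
      D.memory (D.automaton.after e (D.automaton.evolve σ t))
        (D.updateMemory M t e (D.automaton.after e (D.automaton.evolve σ t))) h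

/-- Along a path that starts in `σ` with memory `M`, every random variable could, at the time of
each jump, still have been unexpired up to then: its probability of exceeding its age is positive.
-/
def Possible (D : DecomposedHA n d m k) :
    HState n d → Memory n d k → List (ℝ≥0 × (Fin m ⊕ (Fin n × Fin k))) → Prop
  | _, _, [] => True
  | σ, M, (t, e) :: h =>
      (∀ i, 0 < D.dist i (M i).1 (Ioi ((M i).2 + t))) ∧
        D.Possible (D.automaton.after e (D.automaton.evolve σ t))
          (D.updateMemory M t e (D.automaton.after e (D.automaton.evolve σ t))) h

/-- All random variables have just been sampled in the initial state. -/
def initMemory (D : DecomposedHA n d m k) : Memory n d k :=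
  fun _ => (D.automaton.init, 0)

/-- The law of the remaining time of the `i`-th random variable that was sampled in `s` a time `r`
ago, given that it has not expired. -/
noncomputable def residual (D : DecomposedHA n d m k) (i : Fin k) (s : HState n d) (r : ℝ≥0) :
    Measure ℝ≥0 :=
  ((D.dist i s)[|Ioi r]).map (fun x => x - r)

/-- The law of the duration of the next time step after the initial path `h`, given `h`: the
minimum of the independent remaining times. -/
noncomputable def delayAfter (D : DecomposedHA n d m k)
    (h : List (ℝ≥0 × (Fin m ⊕ (Fin n × Fin k)))) : Measure ℝ≥0 :=
  (Measure.pi (fun i => D.residual i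
      (D.memory D.automaton.init D.initMemory h i).1
      (D.memory D.automaton.init D.initMemory h i).2)).map (fun x => ⨅ j, x j)

end DecomposedHA

/-- An identification of the locations, of some shared variables, and of the jumps of two hybrid
automata. Identified jumps that occur in initial traces are the same tuple on the shared variables,
and neither their guards nor their effect on the shared variables depend on other variables. -/
structure Matching {n₁ d₁ n₂ d₂ : ℕ} {E₁ E₂ : Type} (H₁ : HybridAutomaton n₁ d₁ E₁)
    (H₂ : HybridAutomaton n₂ d₂ E₂) where
  loc : Fin n₁ → Fin n₂
  shared : ℕ
  var₁ : Fin shared ↪ Fin d₁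
  var₂ : Fin shared ↪ Fin d₂
  jump : E₁ → E₂
  source_eq : ∀ e, H₁.Live e → H₂.source (jump e) = loc (H₁.source e)
  target_eq : ∀ e, H₁.Live e → H₂.target (jump e) = loc (H₁.target e)
  guard_eq : ∀ e, H₁.Live e → ∃ g : Set (Fin shared → ℝ),
    (∀ ν, ν ∈ H₁.guard e ↔ ν ∘ var₁ ∈ g) ∧ (∀ ν, ν ∈ H₂.guard (jump e) ↔ ν ∘ var₂ ∈ g)
  reset_eq : ∀ e, H₁.Live e → ∃ r : (Fin shared → ℝ) → (Fin shared → ℝ),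
    (∀ ν, H₁.reset e ν ∘ var₁ = r (ν ∘ var₁)) ∧
      (∀ ν, H₂.reset (jump e) ν ∘ var₂ = r (ν ∘ var₂))

/-- Two states agree on the location and on the shared variables. -/
def Matching.Agree {n₁ d₁ n₂ d₂ : ℕ} {E₁ E₂ : Type} {H₁ : HybridAutomaton n₁ d₁ E₁}
    {H₂ : HybridAutomaton n₂ d₂ E₂} (M : Matching H₁ H₂) (σ₁ : HState n₁ d₁)
    (σ₂ : HState n₂ d₂) : Prop :=
  σ₂.1 = M.loc σ₁.1 ∧ σ₂.2 ∘ M.var₂ = σ₁.2 ∘ M.var₁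

/-- The image of a path under the identification of jumps, with the same delays. -/
def Matching.mapPath {n₁ d₁ n₂ d₂ : ℕ} {E₁ E₂ : Type} {H₁ : HybridAutomaton n₁ d₁ E₁}
    {H₂ : HybridAutomaton n₂ d₂ E₂} (M : Matching H₁ H₂) (h : List (ℝ≥0 × E₁)) :
    List (ℝ≥0 × E₂) :=
  h.map (Prod.map id M.jump)

/-- Pr-equivalence under an identification. -/
structure PrEquiv {n₁ d₁ m₁ k n₂ d₂ m₂ : ℕ} (D : DecomposedHA n₁ d₁ m₁ k)
    (C : ComposedHA n₂ d₂ m₂) (M : Matching D.automaton C.automaton) : Prop where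
  /-- Equal delays and identified jumps lead to the same states; in particular the initial states
  are the same. -/
  states : ∀ h, D.automaton.IsPath D.automaton.init h →
    M.Agree (D.automaton.run D.automaton.init h) (C.automaton.run C.automaton.init (M.mapPath h))
  /-- The sets of initial traces are equal. -/
  traces : ∀ τ, C.automaton.IsTrace C.automaton.init τ ↔
    ∃ τ₁, D.automaton.IsTrace D.automaton.init τ₁ ∧ τ₁.map M.jump = τ
  /-- Each initial trace has the same probability; if several jumps of `D` are identified with the
  same jump of `C`, the probabilities of the corresponding traces of `D` are added up. -/
  prob : ∀ τ, C.automaton.IsTrace C.automaton.init τ →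
    C.pr C.automaton.init τ =
      ∑' τ₁ : {τ₁ : List (Fin m₁ ⊕ (Fin n₁ × Fin k)) // τ₁.map M.jump = τ},
        D.pr D.automaton.init τ₁.1
  /-- After each initial path, and in particular at the start of each initial trace and of each of
  its sub-traces, the next delay has the same distribution function. -/
  delays : ∀ h, D.automaton.IsPath D.automaton.init h →
    D.Possible D.automaton.init D.initMemory h →
    ∀ t : ℝ≥0, D.delayAfter h (Iic t) =
      C.delay (C.automaton.run C.automaton.init (M.mapPath h)) (Iic t)

/-! ### Lebesgue measure on the nonnegative reals -/

/-! Part 1. Call the random variables clocks. What the past of a path contributes to its future is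
the memory: for each clock, the state in which it was sampled and its age. Given that no clock has
expired, the remaining times are independent with the conditional tail laws. So the state enriched
by the memory evolves in a Markovian way: the first expiry has a density, proportional to
`totalWeight` of the aged memory, and given its time the clock `i` is the one that expires with
probability `weight i / totalWeight`. Ages are variables of rate 1, and a sampling state is stored
in one constant real variable through a Borel embedding, so finitely many auxiliary variables
suffice. All jumps of `D`, including its resampling jumps, become given jumps of the composed
automaton. Each state enables exactly one jump per label, hence the expiring clock determines the
jump, and the resampling jumps of the composed scheduling never fire.

Equality of trace probabilities is proved without normalization: `mass_mul_pr_compose` multiplies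
the composed probability by the probability `mass M` that all clocks exceed their ages, and compares
it with an integral over the unnormalized law `remainingLaw M`. The induction on the trace rests on
`lintegral_pi_argmin` (disintegration along the smallest coordinate), which gives
`lintegral_prElapse_cons`, and on the cancellation of `totalWeight`. Initially the mass is 1. The
delay laws agree by `map_pi_residual`.

Part 2. In `branchHA` the initial delay is uniform on `(0, 10)`, then one of two always enabled
jumps is taken, and every later delay exceeds 20. In a decomposed counterpart the two jumps
correspond to `f₀ ≠ f₁`, enabled in a common state, so their labels differ. After delay 0 and the
jump `f₀`, every clock except that of `f₀` still has its initial law, and the minimum exceeds 20;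
likewise for `f₁`. Each clock differs from at least one of the two labels, so all clocks initially
exceed 20 almost surely, which contradicts the initial delay. -/

lemma NNReal.measurableEmbedding_coe : MeasurableEmbedding ((↑) : ℝ≥0 → ℝ) :=
  MeasurableEmbedding.subtype_coe measurableSet_Ici

lemma lebesgueNN_apply (s : Set ℝ≥0) : lebesgueNN s = volume (((↑) : ℝ≥0 → ℝ) '' s) :=
  NNReal.measurableEmbedding_coe.comap_apply _ _

instance : SigmaFinite lebesgueNN := by
  refine ⟨⟨⟨fun n => Iic (n : ℝ≥0), fun _ => trivial, fun n => ?_, ?_⟩⟩⟩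
  · rw [lebesgueNN_apply]
    refine (measure_mono (t := Icc (0 : ℝ) n) ?_).trans_lt (by simp)
    rintro _ ⟨x, hx, rfl⟩
    exact ⟨x.2, by exact_mod_cast hx⟩
  · refine eq_univ_of_forall fun x => mem_iUnion.2 ?_
    exact exists_nat_ge x

lemma lebesgueNN_singleton (x : ℝ≥0) : lebesgueNN {x} = 0 := by
  rw [lebesgueNN_apply, image_singleton, Real.volume_singleton]

lemma measure_singleton_of_ac {μ : Measure ℝ≥0} (h : μ ≪ lebesgueNN) : NullSingletonClass μ :=
  ⟨fun x => h (lebesgueNN_singleton x)⟩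

/-- This is translation invariance of Lebesgue measure on the line, restricted to the image `[r, ∞)`
of the shift; the endpoint is null. -/
lemma lebesgueNN_map_add (r : ℝ≥0) :
    lebesgueNN.map (fun t => t + r) = lebesgueNN.restrict (Ioi r) := by
  have hm : Measurable (fun t : ℝ≥0 => t + r) := measurable_id.add_const r
  have h0 : NullSingletonClass lebesgueNN := ⟨lebesgueNN_singleton⟩
  rw [Measure.restrict_congr_set Ioi_ae_eq_Ici]
  ext s hs
  rw [Measure.map_apply hm hs, Measure.restrict_apply hs, lebesgueNN_apply, lebesgueNN_apply]
  have : ((↑) : ℝ≥0 → ℝ) '' ((fun t => t + r) ⁻¹' s)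
      = (fun x : ℝ => x + r) ⁻¹' (((↑) : ℝ≥0 → ℝ) '' (s ∩ Ici r)) := by
    ext x
    constructor
    · rintro ⟨t, ht, rfl⟩
      exact ⟨t + r, ⟨ht, mem_Ici.2 le_add_self⟩, by simp⟩
    · rintro ⟨y, ⟨hy, hry⟩, hxy⟩
      have hry : r ≤ y := hry
      refine ⟨y - r, ?_, ?_⟩
      · simpa [tsub_add_cancel_of_le hry] using hy
      · rw [NNReal.coe_sub hry, hxy]; simp
  rw [this, measure_preimage_add_right]

/-! ### Tails of laws on the nonnegative reals -/

/-- The law of `X - r` on the event `X > r`, without normalization. -/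
noncomputable def tail (μ : Measure ℝ≥0) (r : ℝ≥0) : Measure ℝ≥0 :=
  (μ.restrict (Ioi r)).map (fun x => x - r)

lemma measurable_sub_right (r : ℝ≥0) : Measurable (fun x : ℝ≥0 => x - r) :=
  measurable_id.sub_const r

instance (μ : Measure ℝ≥0) [IsFiniteMeasure μ] (r : ℝ≥0) : IsFiniteMeasure (tail μ r) := by
  unfold tail; infer_instance

lemma tail_univ (μ : Measure ℝ≥0) (r : ℝ≥0) : tail μ r univ = μ (Ioi r) := by
  rw [tail, Measure.map_apply (measurable_sub_right r) .univ]; simp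

lemma tail_zero {μ : Measure ℝ≥0} (h : μ ≪ lebesgueNN) : tail μ 0 = μ := by
  have : μ {0}ᶜᶜ = 0 := by rw [compl_compl]; exact h (lebesgueNN_singleton 0)
  have h1 : (Ioi 0 : Set ℝ≥0) = {0}ᶜ := by ext x; simp [pos_iff_ne_zero]
  have h2 : μ.restrict (Ioi 0) = μ := by
    rw [h1]; exact Measure.restrict_eq_self_of_ae_mem this
  simp [tail, h2]

/-- The event `X > r + t` lies in `X > r`, so truncating in two stages loses nothing. This turns the
tails in `lintegral_pi_argmin` into those of the aged memory. -/
lemma tail_tail (μ : Measure ℝ≥0) (r t : ℝ≥0) : tail (tail μ r) t = tail μ (r + t) := by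
  ext s hs
  have h1 := measurable_sub_right r
  have h2 := measurable_sub_right t
  rw [tail, Measure.map_apply h2 hs, Measure.restrict_apply (h2 hs), tail,
    Measure.map_apply h1 ((h2 hs).inter measurableSet_Ioi),
    Measure.restrict_apply (h1 ((h2 hs).inter measurableSet_Ioi)), tail,
    Measure.map_apply (measurable_sub_right _) hs,
    Measure.restrict_apply (measurable_sub_right _ hs)]
  congr 1
  ext x
  simp only [mem_inter_iff, mem_preimage, mem_Ioi, tsub_tsub, lt_tsub_iff_left]
  constructor
  · rintro ⟨⟨h, h'⟩, -⟩; exact ⟨h, h'⟩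
  · rintro ⟨h, h'⟩; exact ⟨⟨h, h'⟩, lt_of_le_of_lt le_self_add h'⟩

lemma tail_withDensity {f : ℝ≥0 → ℝ≥0∞} (hf : Measurable f) (r : ℝ≥0) :
    tail (lebesgueNN.withDensity f) r = lebesgueNN.withDensity (fun t => f (t + r)) := by
  ext s hs
  have h1 := measurable_sub_right r
  have hm : Measurable (fun t : ℝ≥0 => t + r) := measurable_id.add_const r
  rw [tail, Measure.map_apply h1 hs, Measure.restrict_apply (h1 hs),
    withDensity_apply _ ((h1 hs).inter measurableSet_Ioi), withDensity_apply _ hs,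
    ← Measure.restrict_restrict (h1 hs), ← lebesgueNN_map_add,
    Measure.restrict_map hm (h1 hs), lintegral_map hf hm]
  have : (fun t => t + r) ⁻¹' ((fun x => x - r) ⁻¹' s) = s := by ext x; simp
  rw [this]

lemma tail_ac {μ : Measure ℝ≥0} (h : μ ≪ lebesgueNN) (r : ℝ≥0) : tail μ r ≪ lebesgueNN := by
  refine Measure.AbsolutelyContinuous.mk fun s hs h0 => ?_
  rw [tail, Measure.map_apply (measurable_sub_right r) hs,
    Measure.restrict_apply (measurable_sub_right r hs)]
  refine h ?_
  have hm : Measurable (fun t : ℝ≥0 => t + r) := measurable_id.add_const r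
  rw [← Measure.restrict_apply (measurable_sub_right r hs), ← lebesgueNN_map_add,
    Measure.map_apply hm (measurable_sub_right r hs), ← h0]
  congr 1
  ext x; simp

/-- Absolutely continuous kernels have a jointly measurable finite density. -/
lemma exists_measurable_density {α : Type*} [MeasurableSpace α] (κ : Kernel α ℝ≥0)
    [IsFiniteKernel κ] (h : ∀ a, κ a ≪ lebesgueNN) :
    ∃ f : α → ℝ≥0 → ℝ≥0∞, Measurable (Function.uncurry f) ∧ (∀ a x, f a x < ∞) ∧
      ∀ a, κ a = lebesgueNN.withDensity (f a) := by
  -- The kernel derivative is taken against a finite measure equivalent to Lebesgue measure; the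
  -- factor `g` converts the density back.
  set ρ := lebesgueNN.toFinite
  have hρ : lebesgueNN ≪ ρ := absolutelyContinuous_toFinite _
  have hρ' : ρ ≪ lebesgueNN := toFinite_absolutelyContinuous _
  set η : Kernel α ℝ≥0 := Kernel.const α ρ
  set g : ℝ≥0 → ℝ≥0∞ := ρ.rnDeriv lebesgueNN
  have hg : Measurable g := Measure.measurable_rnDeriv _ _
  have hgw : lebesgueNN.withDensity g = ρ := Measure.withDensity_rnDeriv_eq _ _ hρ'
  have hf : Measurable (fun p : α × ℝ≥0 => Kernel.rnDeriv κ η p.1 p.2 * g p.2) :=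
    (Kernel.measurable_rnDeriv κ η).mul (hg.comp measurable_snd)
  have hκ : ∀ a, κ a = lebesgueNN.withDensity (fun x => Kernel.rnDeriv κ η a x * g x) := fun a => by
    have h1 : Kernel.withDensity η (Kernel.rnDeriv κ η) a = κ a :=
      Kernel.withDensity_rnDeriv_eq ((h a).trans hρ)
    rw [Kernel.withDensity_apply _ (Kernel.measurable_rnDeriv κ η)] at h1
    rw [← h1, Kernel.const_apply, ← hgw, ← withDensity_mul _ hg
      (Kernel.measurable_rnDeriv_right κ η a)]
    congr 1; ext x; simp [mul_comm]
  -- The value `∞` occurs only on null sets, since `κ a` is finite; it is replaced by 0 so that the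
  -- density is finite everywhere and weights can be cancelled pointwise.
  refine ⟨fun a x => if Kernel.rnDeriv κ η a x * g x = ∞ then 0 else Kernel.rnDeriv κ η a x * g x,
    ?_, ?_, ?_⟩
  · exact Measurable.ite (hf (measurableSet_singleton ∞)) measurable_const hf
  · intro a x
    dsimp only
    split_ifs with h
    · simp
    · exact lt_top_iff_ne_top.2 h
  · intro a
    rw [hκ a]
    refine withDensity_congr_ae ?_
    have hfin : ∀ᵐ x ∂lebesgueNN, Kernel.rnDeriv κ η a x * g x < ∞ := by
      refine ae_lt_top (hf.comp measurable_prodMk_left) ?_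
      rw [← setLIntegral_univ, ← withDensity_apply _ .univ, ← hκ a]
      exact measure_ne_top _ _
    filter_upwards [hfin] with x hx
    rw [if_neg hx.ne]

/-! ### The smallest coordinate under a product measure -/

section Pi

variable {k : ℕ}

lemma measurable_update_pair (i : Fin k) :
    Measurable (fun p : ℝ≥0 × (Fin k → ℝ≥0) => Function.update p.2 i p.1) := by
  refine measurable_pi_lambda _ fun j => ?_
  by_cases h : j = i
  · subst h; simpa using measurable_fst
  · simp only [Function.update_of_ne h]; fun_prop

lemma isFiniteMeasure_update (μ : Fin k → Measure ℝ≥0) [∀ j, IsFiniteMeasure (μ j)]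
    (ν : Measure ℝ≥0) [IsFiniteMeasure ν] (i j : Fin k) :
    IsFiniteMeasure (Function.update μ i ν j) := by
  by_cases h : j = i
  · subst h; simpa using ‹IsFiniteMeasure ν›
  · simp only [Function.update_of_ne h]; infer_instance

/-- Tonelli's theorem for one coordinate. The Dirac measure is a placeholder that keeps the index
type `Fin k`: the coordinate it governs is overwritten by `t`. -/
lemma lintegral_pi_update (μ : Fin k → Measure ℝ≥0) [∀ j, IsFiniteMeasure (μ j)]
    (ν : Measure ℝ≥0) [IsFiniteMeasure ν] (i : Fin k) {F : (Fin k → ℝ≥0) → ℝ≥0∞}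
    (hF : Measurable F) :
    ∫⁻ x, F x ∂(Measure.pi (Function.update μ i ν)) =
      ∫⁻ t, ∫⁻ x, F (Function.update x i t)
        ∂(Measure.pi (Function.update μ i (Measure.dirac 0))) ∂ν := by
  have := isFiniteMeasure_update μ ν i
  have := isFiniteMeasure_update μ (Measure.dirac 0) i
  have hmap : Measure.pi (Function.update μ i ν) =
      (ν.prod (Measure.pi (Function.update μ i (Measure.dirac 0)))).map
        (fun p => Function.update p.2 i p.1) := by
    refine (Measure.pi_eq fun s hs => ?_)
    rw [Measure.map_apply (measurable_update_pair i) (.univ_pi hs)]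
    have : (fun p : ℝ≥0 × (Fin k → ℝ≥0) => Function.update p.2 i p.1) ⁻¹' (univ.pi s)
        = s i ×ˢ univ.pi (Function.update s i univ) := by
      ext p
      simp only [mem_preimage, mem_univ_pi, mem_prod]
      constructor
      · intro h
        refine ⟨by simpa using h i, fun j => ?_⟩
        by_cases hj : j = i
        · subst hj; simp
        · simpa [hj] using h j
      · rintro ⟨h1, h2⟩ j
        by_cases hj : j = i
        · subst hj; simpa using h1
        · simpa [hj] using h2 j
    rw [this, Measure.prod_prod, Measure.pi_pi,
      ← Finset.mul_prod_erase _ _ (Finset.mem_univ i),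
      ← Finset.mul_prod_erase _ _ (Finset.mem_univ i)]
    simp only [Function.update_self, measure_univ, one_mul]
    congr 1
    refine Finset.prod_congr rfl fun j hj => ?_
    simp [Finset.ne_of_mem_erase hj]
  rw [hmap, lintegral_map hF (measurable_update_pair i),
    lintegral_prod (fun p : ℝ≥0 × (Fin k → ℝ≥0) => F (Function.update p.2 i p.1))
      (hF.comp (measurable_update_pair i)).aemeasurable]

lemma measurable_iInf_fin : Measurable (fun x : Fin k → ℝ≥0 => ⨅ j, x j) :=
  Measurable.iInf fun j => measurable_pi_apply j

lemma iInf_fin_le (x : Fin k → ℝ≥0) (i : Fin k) : ⨅ j, x j ≤ x i :=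
  ciInf_le (OrderBot.bddBelow _) i

/-- Restriction and map both act coordinatewise. The placeholder at 0 survives because subtraction
is truncated, and `Ici` may replace the `Ioi` of `tail` because there are no atoms. -/
lemma map_sub_restrict_pi (μ : Fin k → Measure ℝ≥0) [∀ j, IsFiniteMeasure (μ j)]
    [∀ j, NullSingletonClass (μ j)] (i : Fin k) (t : ℝ≥0) :
    ((Measure.pi (Function.update μ i (Measure.dirac 0))).restrict
      (univ.pi fun j => if j = i then univ else Ici t)).map (fun x j => x j - t) =
    Measure.pi (Function.update (fun j => tail (μ j) t) i (Measure.dirac 0)) := by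
  have := isFiniteMeasure_update μ (Measure.dirac 0) i
  have : ∀ j, IsFiniteMeasure (((Function.update μ i (Measure.dirac 0) j).restrict
      (if j = i then univ else Ici t)).map (fun x => x - t)) := fun j => inferInstance
  rw [Measure.restrict_pi_pi, Measure.pi_map_pi (f := fun _ x => x - t)
    (fun j => (measurable_sub_right t).aemeasurable)]
  congr 1
  ext j : 1
  by_cases h : j = i
  · subst h
    simp [Measure.map_dirac' (measurable_sub_right t)]
  · simp only [Function.update_of_ne h, if_neg h, tail,
      Measure.restrict_congr_set (Ioi_ae_eq_Ici (μ := μ j))]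

/-- Integration over the event that the `i`-th coordinate is the smallest. -/
lemma lintegral_pi_argmin (μ : Fin k → Measure ℝ≥0) [∀ j, IsFiniteMeasure (μ j)]
    [∀ j, NullSingletonClass (μ j)] (i : Fin k) {Φ : ℝ≥0 → (Fin k → ℝ≥0) → ℝ≥0∞}
    (hΦ : Measurable (Function.uncurry Φ)) :
    ∫⁻ x, (if x i = ⨅ j, x j then Φ (⨅ j, x j) (fun j => x j - ⨅ j, x j) else 0)
        ∂(Measure.pi μ) =
      ∫⁻ t, ∫⁻ x, Φ t x
        ∂(Measure.pi (Function.update (fun j => tail (μ j) t) i (Measure.dirac 0))) ∂(μ i) := by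
  have : Nonempty (Fin k) := ⟨i⟩
  have hsub : Measurable (fun x : Fin k → ℝ≥0 => fun j => x j - ⨅ j, x j) :=
    measurable_pi_lambda _ fun j => (measurable_pi_apply j).sub measurable_iInf_fin
  have hF : Measurable (fun x : Fin k → ℝ≥0 =>
      if x i = ⨅ j, x j then Φ (⨅ j, x j) (fun j => x j - ⨅ j, x j) else 0) :=
    Measurable.ite (measurableSet_eq_fun (measurable_pi_apply i) measurable_iInf_fin)
      (hΦ.comp (measurable_iInf_fin.prodMk hsub)) measurable_const
  have hU := lintegral_pi_update μ (μ i) i hF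
  rw [Function.update_eq_self] at hU
  rw [hU]
  refine lintegral_congr fun t => ?_
  have hmeas : Measurable (fun (x : Fin k → ℝ≥0) j => x j - t) :=
    by fun_prop
  have hS : MeasurableSet (univ.pi fun j => if j = i then univ else Ici t : Set (Fin k → ℝ≥0)) :=
    .univ_pi fun j => by split_ifs; exacts [.univ, measurableSet_Ici]
  rw [← map_sub_restrict_pi, lintegral_map (f := Φ t) (hΦ.comp measurable_prodMk_left) hmeas,
    ← lintegral_indicator hS]
  have hae : ∀ᵐ x ∂(Measure.pi (Function.update μ i (Measure.dirac 0))), x i = 0 := by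
    have := isFiniteMeasure_update μ (Measure.dirac 0) i
    exact Measure.pi_eval_preimage_null _ (s := {0}ᶜ) (by simp)
  refine lintegral_congr_ae ?_
  filter_upwards [hae] with x hx0
  by_cases hx : x ∈ (univ.pi fun j => if j = i then univ else Ici t : Set (Fin k → ℝ≥0))
  · have hle : ∀ j, j ≠ i → t ≤ x j := fun j hj => by
      have := hx j (mem_univ j); simpa [hj] using this
    have hmin : ⨅ j, Function.update x i t j = t := by
      refine le_antisymm ((iInf_fin_le _ i).trans (by simp)) (le_ciInf fun j => ?_)
      by_cases hj : j = i
      · subst hj; simp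
      · simpa [hj] using hle j hj
    rw [indicator_of_mem hx, hmin, if_pos (by simp)]
    congr 1
    ext j
    by_cases hj : j = i
    · subst hj; simp [hx0]
    · simp [hj]
  · rw [indicator_of_notMem hx, if_neg]
    intro h
    refine hx fun j _ => ?_
    by_cases hj : j = i
    · simp [hj]
    · have := iInf_fin_le (Function.update x i t) j
      rw [← h] at this
      simpa [hj] using this

/-- For a fixed value of the `i`-th coordinate, a tie puts the `j`-th one on a single point, which
is null. -/
lemma ae_unique_argmin (μ : Fin k → Measure ℝ≥0) [∀ j, IsFiniteMeasure (μ j)]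
    [∀ j, NullSingletonClass (μ j)] {i j : Fin k} (hij : i ≠ j) :
    ∀ᵐ x ∂(Measure.pi μ), x i ≠ x j := by
  have hS : MeasurableSet {x : Fin k → ℝ≥0 | x i = x j} :=
    measurableSet_eq_fun (measurable_pi_apply i) (measurable_pi_apply j)
  have hU := lintegral_pi_update μ (μ i) i
    (F := indicator {x : Fin k → ℝ≥0 | x i = x j} 1) (measurable_one.indicator hS)
  rw [Function.update_eq_self, lintegral_indicator_one hS] at hU
  have := isFiniteMeasure_update μ (Measure.dirac 0) i
  rw [ae_iff]
  simp only [not_not]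
  rw [hU, lintegral_eq_zero_of_ae_eq_zero]
  refine Filter.Eventually.of_forall fun t => ?_
  have hc : NullSingletonClass (Function.update μ i (Measure.dirac 0) j) := by
    rw [Function.update_of_ne hij.symm]; infer_instance
  refine lintegral_eq_zero_of_ae_eq_zero ?_
  have := Measure.pi_hyperplane (Function.update μ i (Measure.dirac 0)) j t
  filter_upwards [compl_mem_ae_iff.2 this] with x hx
  simp only [mem_compl_iff, mem_ofPred_eq] at hx
  simp [hij.symm, Ne.symm hx]

/-- The law of the smallest coordinate, decomposed according to the coordinate. -/
lemma lintegral_pi_iInf [Nonempty (Fin k)] (μ : Fin k → Measure ℝ≥0) [∀ j, IsFiniteMeasure (μ j)]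
    [∀ j, NullSingletonClass (μ j)] {φ : ℝ≥0 → ℝ≥0∞} (hφ : Measurable φ) :
    ∫⁻ x, φ (⨅ j, x j) ∂(Measure.pi μ) =
      ∑ i, ∫⁻ t, φ t * ∏ j ∈ Finset.univ.erase i, μ j (Ioi t) ∂(μ i) := by
  have h1 : ∀ i, ∫⁻ t, φ t * ∏ j ∈ Finset.univ.erase i, μ j (Ioi t) ∂(μ i) =
      ∫⁻ x, (if x i = ⨅ j, x j then φ (⨅ j, x j) else 0) ∂(Measure.pi μ) := fun i => by
    rw [lintegral_pi_argmin μ i (Φ := fun t _ => φ t) (hφ.comp measurable_fst)]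
    refine lintegral_congr fun t => ?_
    have := isFiniteMeasure_update (fun j => tail (μ j) t) (Measure.dirac 0) i
    rw [lintegral_const, Measure.pi_univ, ← Finset.mul_prod_erase _ _ (Finset.mem_univ i)]
    simp only [Function.update_self, measure_univ, one_mul]
    congr 1
    refine Finset.prod_congr rfl fun j hj => ?_
    rw [Function.update_of_ne (Finset.ne_of_mem_erase hj), tail_univ]
  simp_rw [h1]
  rw [← lintegral_finsetSum]
  rotate_left
  · exact fun i _ => Measurable.ite
      (measurableSet_eq_fun (measurable_pi_apply i) measurable_iInf_fin)
      (hφ.comp measurable_iInf_fin) measurable_const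
  -- Without ties exactly one of the summands is active, so the sum over the possible minimizers
  -- counts each point once.
  have hne : ∀ᵐ x ∂(Measure.pi μ), ∀ i j, i ≠ j → x i ≠ x j := by
    simp only [ae_all_iff]
    exact fun i j hij => ae_unique_argmin μ hij
  refine lintegral_congr_ae ?_
  filter_upwards [hne] with x hx
  obtain ⟨i, hi⟩ := exists_eq_ciInf_of_finite (f := x)
  rw [Finset.sum_eq_single i]
  · rw [if_pos hi]
  · intro j _ hj
    rw [if_neg]
    rw [← hi]
    exact hx j i hj
  · simp

end Pi

/-! ### Adding variables of constant rate -/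

section ConstantRate

variable {d d' : ℕ} {α : Type*} (e : Fin d ⊕ α ≃ Fin d')

/-- The vector field `F` on the first summand, extended by the constant rates `c`. -/
def extendField (F : (Fin d → ℝ) → (Fin d → ℝ)) (c : α → ℝ) (ν : Fin d' → ℝ) : Fin d' → ℝ :=
  fun v => Sum.elim (F fun i => ν (e (Sum.inl i))) c (e.symm v)

lemma TimeStep.existsUnique_evolveVal {F : (Fin d → ℝ) → (Fin d → ℝ)} {ν : Fin d → ℝ} {t : ℝ≥0}
    (h : ∃! ν', TimeStep F ν t ν') (ν' : Fin d → ℝ) :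
    TimeStep F ν t ν' ↔ ν' = evolveVal F ν t := by
  have hs : TimeStep F ν t (evolveVal F ν t) := Classical.epsilon_spec h.exists
  exact ⟨fun h' => h.unique h' hs, fun h' => h' ▸ hs⟩

lemma timeStep_extendField_iff (F : (Fin d → ℝ) → (Fin d → ℝ)) (c : α → ℝ) (ν : Fin d' → ℝ)
    (t : ℝ≥0) (ν' : Fin d' → ℝ) :
    TimeStep (extendField e F c) ν t ν' ↔
      TimeStep F (fun i => ν (e (Sum.inl i))) t (fun i => ν' (e (Sum.inl i))) ∧
        ∀ a, ν' (e (Sum.inr a)) = ν (e (Sum.inr a)) + c a * t := by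
  constructor
  · rintro ⟨f, hf, h0, ht, hd⟩
    have hd' : ∀ s ∈ Ioo (0 : ℝ) t, ∀ v, HasDerivAt (fun s => f s v)
        (extendField e F c (f s) v) s := fun s hs => hasDerivAt_pi.1 (hd s hs)
    refine ⟨⟨fun s i => f s (e (Sum.inl i)), ?_, by simp [h0], by simp [ht], fun s hs => ?_⟩,
      fun a => ?_⟩
    · exact continuousOn_pi.2 fun i => continuousOn_pi.1 hf _
    · refine hasDerivAt_pi.2 fun i => ?_
      simpa [extendField] using hd' s hs (e (Sum.inl i))
    · rcases eq_or_lt_of_le t.2 with h | h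
      · have h : (t : ℝ) = 0 := h.symm
        rw [← ht, ← h0, h]; simp
      -- By the mean value theorem a coordinate with constant derivative is affine; this needs a
      -- nondegenerate interval, hence the separate case `t = 0`.
      · obtain ⟨s, -, hs⟩ := exists_hasDerivAt_eq_slope (fun s => f s (e (Sum.inr a)))
          (fun _ => c a) h (continuousOn_pi.1 hf _) fun s hs => by
            simpa [extendField] using hd' s hs (e (Sum.inr a))
        rw [eq_div_iff (by simpa using h.ne')] at hs
        simp only [NNReal.val_eq_coe, h0, ht, sub_zero] at hs
        rw [hs]; ring
  · rintro ⟨⟨g, hg, h0, ht, hd⟩, ha⟩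
    refine ⟨fun s v => Sum.elim (g s) (fun a => ν (e (Sum.inr a)) + c a * s) (e.symm v),
      ?_, ?_, ?_, fun s hs => ?_⟩
    · refine continuousOn_pi.2 fun v => ?_
      obtain ⟨w, rfl⟩ := e.surjective v
      rcases w with i | a
      · simpa using continuousOn_pi.1 hg i
      · simp only [Equiv.symm_apply_apply, Sum.elim_inr]; fun_prop
    · ext v
      obtain ⟨w, rfl⟩ := e.surjective v
      rcases w with i | a <;> simp [h0]
    · ext v
      obtain ⟨w, rfl⟩ := e.surjective v
      rcases w with i | a <;> simp [ht, ha]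
    · refine hasDerivAt_pi.2 fun v => ?_
      obtain ⟨w, rfl⟩ := e.surjective v
      rcases w with i | a
      · simpa [extendField] using hasDerivAt_pi.1 (hd s hs) i
      · simpa [extendField] using ((hasDerivAt_id s).const_mul (c a)).const_add (ν (e (Sum.inr a)))

lemma timeStep_extendField_iff_eq {F : (Fin d → ℝ) → (Fin d → ℝ)} {t : ℝ≥0}
    (hF : ∀ ν, ∃! ν', TimeStep F ν t ν') (c : α → ℝ) (ν ν' : Fin d' → ℝ) :
    TimeStep (extendField e F c) ν t ν' ↔
      ν' = fun v => Sum.elim (evolveVal F (fun i => ν (e (Sum.inl i))) t)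
        (fun a => ν (e (Sum.inr a)) + c a * t) (e.symm v) := by
  rw [timeStep_extendField_iff, TimeStep.existsUnique_evolveVal (hF _)]
  constructor
  · rintro ⟨h1, h2⟩
    ext v
    obtain ⟨w, rfl⟩ := e.surjective v
    rcases w with i | a
    · simpa using congrFun h1 i
    · simpa using h2 a
  · rintro rfl
    simp

lemma existsUnique_timeStep_extendField {F : (Fin d → ℝ) → (Fin d → ℝ)} {t : ℝ≥0}
    (hF : ∀ ν, ∃! ν', TimeStep F ν t ν') (c : α → ℝ) (ν : Fin d' → ℝ) :
    ∃! ν', TimeStep (extendField e F c) ν t ν' :=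
  ⟨_, (timeStep_extendField_iff_eq e hF c ν _).2 rfl,
    fun _ h => (timeStep_extendField_iff_eq e hF c ν _).1 h⟩

lemma evolveVal_extendField {F : (Fin d → ℝ) → (Fin d → ℝ)} {t : ℝ≥0}
    (hF : ∀ ν, ∃! ν', TimeStep F ν t ν') (c : α → ℝ) (ν : Fin d' → ℝ) :
    evolveVal (extendField e F c) ν t =
      fun v => Sum.elim (evolveVal F (fun i => ν (e (Sum.inl i))) t)
        (fun a => ν (e (Sum.inr a)) + c a * t) (e.symm v) :=
  (timeStep_extendField_iff_eq e hF c ν _).1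
    (Classical.epsilon_spec (existsUnique_timeStep_extendField e hF c ν).exists)

lemma measurable_evolveVal_extendField {F : (Fin d → ℝ) → (Fin d → ℝ)}
    (hF : ∀ ν (t : ℝ≥0), ∃! ν', TimeStep F ν t ν')
    (hm : Measurable (fun p : (Fin d → ℝ) × ℝ≥0 => evolveVal F p.1 p.2)) (c : α → ℝ) :
    Measurable (fun p : (Fin d' → ℝ) × ℝ≥0 => evolveVal (extendField e F c) p.1 p.2) := by
  refine measurable_pi_lambda _ fun v => ?_
  obtain ⟨w, rfl⟩ := e.surjective v
  simp only [evolveVal_extendField e (fun ν => hF ν _)]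
  rcases w with i | a
  · simp only [Equiv.symm_apply_apply, Sum.elim_inl]
    have h : Measurable (fun p : (Fin d' → ℝ) × ℝ≥0 =>
        ((fun i => p.1 (e (Sum.inl i)) : Fin d → ℝ), p.2)) := by fun_prop
    exact (measurable_pi_apply i).comp (hm.comp h)
  · simp only [Equiv.symm_apply_apply, Sum.elim_inr]
    fun_prop

end ConstantRate

/-! ### Measurability in hybrid automata -/

instance {α β : Type*} [MeasurableSpace α] [MeasurableSpace β] [DiscreteMeasurableSpace α]
    [DiscreteMeasurableSpace β] : DiscreteMeasurableSpace (α ⊕ β) :=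
  ⟨fun _ => measurableSet_sum_iff.2 ⟨.of_discrete, .of_discrete⟩⟩

namespace HybridAutomaton

variable {n d : ℕ} {E : Type} {H : HybridAutomaton n d E}

lemma measurable_after (H : HybridAutomaton n d E) {e : E} (h : Measurable (H.reset e)) :
    Measurable (H.after e) :=
  measurable_const.prodMk (h.comp measurable_snd)

lemma measurableSet_enabled (H : HybridAutomaton n d E) {e : E} (h : MeasurableSet (H.guard e)) :
    MeasurableSet {σ | H.Enabled e σ} :=
  (measurableSet_eq_fun measurable_const measurable_fst).inter (measurable_snd h)

lemma measurable_evolve_prod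
    (h : ∀ ℓ, Measurable (fun p : (Fin d → ℝ) × ℝ≥0 => evolveVal (H.flow ℓ) p.1 p.2)) :
    Measurable (fun p : HState n d × ℝ≥0 => H.evolve p.1 p.2) := by
  have : Measurable (fun p : Fin n × ((Fin d → ℝ) × ℝ≥0) => H.evolve (p.1, p.2.1) p.2.2) :=
    measurable_from_prod_countable_right fun ℓ => measurable_const.prodMk (h ℓ)
  exact this.comp (measurable_fst.fst.prodMk (measurable_fst.snd.prodMk measurable_snd))

lemma WellPosed.measurableSet_guard_composedExtension {m : ℕ} {H : HybridAutomaton n d (Fin m)}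
    (h : H.WellPosed) (e : Fin m ⊕ Fin n) : MeasurableSet (H.composedExtension.guard e) := by
  rcases e with e | ℓ
  · exact h.measurableSet_guard e
  · exact (MeasurableSet.biUnion (to_countable _) fun e _ => h.measurableSet_guard e).compl

lemma WellPosed.measurable_reset_composedExtension {m : ℕ} {H : HybridAutomaton n d (Fin m)}
    (h : H.WellPosed) (e : Fin m ⊕ Fin n) : Measurable (H.composedExtension.reset e) := by
  rcases e with e | ℓ
  · exact h.measurable_reset e
  · exact measurable_id

end HybridAutomaton

namespace ComposedHA

variable {n d m : ℕ} (C : ComposedHA n d m)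

instance : IsMarkovKernel C.delay := C.isMarkovKernel_delay
instance : IsMarkovKernel C.choice := C.isMarkovKernel_choice

lemma measurable_evolve : Measurable (fun p : HState n d × ℝ≥0 => C.automaton.evolve p.1 p.2) :=
  HybridAutomaton.measurable_evolve_prod C.wellPosed.measurable_evolve

lemma measurable_after (e : Fin m ⊕ Fin n) : Measurable (C.automaton.after e) :=
  HybridAutomaton.measurable_after _ (C.wellPosed.measurable_reset_composedExtension e)

lemma measurableSet_enabled (e : Fin m ⊕ Fin n) : MeasurableSet {σ | C.automaton.Enabled e σ} :=
  HybridAutomaton.measurableSet_enabled _ (C.wellPosed.measurableSet_guard_composedExtension e)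

lemma measurable_pr (τ : List (Fin m ⊕ Fin n)) : Measurable (fun σ => C.pr σ τ) := by
  induction τ with
  | nil => exact measurable_const
  | cons e τ ih =>
    have hS : MeasurableSet
        {p : HState n d × ℝ≥0 | C.automaton.Enabled e (C.automaton.evolve p.1 p.2)} :=
      C.measurable_evolve (C.measurableSet_enabled e)
    have hf : Measurable (fun p : HState n d × ℝ≥0 => C.choice (C.automaton.evolve p.1 p.2) {e} *
        C.pr (C.automaton.after e (C.automaton.evolve p.1 p.2)) τ) :=
      ((C.choice.measurable_coe (measurableSet_singleton e)).comp C.measurable_evolve).mul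
        (ih.comp ((C.measurable_after e).comp C.measurable_evolve))
    have := (hf.indicator hS).lintegral_kernel_prod_right' (κ := C.delay)
    convert this using 2 with σ
    have hσ : MeasurableSet {t | C.automaton.Enabled e (C.automaton.evolve σ t)} :=
      measurable_prodMk_left (x := σ) hS
    rw [pr, ← lintegral_indicator hσ]
    rfl

end ComposedHA

namespace DecomposedHA

variable {n d m k : ℕ} (D : DecomposedHA n d m k)

instance (i : Fin k) : IsMarkovKernel (D.dist i) := D.isMarkovKernel_dist i

lemma nonempty_fin (D : DecomposedHA n d m k) : Nonempty (Fin k) := ⟨⟨0, D.k_pos⟩⟩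

lemma measurable_evolve : Measurable (fun p : HState n d × ℝ≥0 => D.automaton.evolve p.1 p.2) :=
  HybridAutomaton.measurable_evolve_prod D.wellPosed.measurable_evolve

lemma measurableSet_guard (e : Fin m ⊕ (Fin n × Fin k)) : MeasurableSet (D.automaton.guard e) := by
  rcases e with e | ℓ
  · exact D.wellPosed.measurableSet_guard e
  · exact (MeasurableSet.biUnion (to_countable _)
      fun e _ => D.wellPosed.measurableSet_guard e).compl

lemma measurable_reset (e : Fin m ⊕ (Fin n × Fin k)) : Measurable (D.automaton.reset e) := by
  rcases e with e | ℓ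
  · exact D.wellPosed.measurable_reset e
  · exact measurable_id

lemma measurable_after (e : Fin m ⊕ (Fin n × Fin k)) : Measurable (D.automaton.after e) :=
  HybridAutomaton.measurable_after _ (D.measurable_reset e)

lemma measurableSet_enabled (e : Fin m ⊕ (Fin n × Fin k)) :
    MeasurableSet {σ | D.automaton.Enabled e σ} :=
  HybridAutomaton.measurableSet_enabled _ (D.measurableSet_guard e)

/-- In every state exactly one jump of each label is enabled. -/
lemma existsUnique_enabled (σ : HState n d) (i : Fin k) :
    ∃! e, D.automaton.Enabled e σ ∧ D.label e = i := by
  have hres : ∀ e ℓ j, D.automaton.Enabled (Sum.inl e) σ → D.automaton.Enabled (Sum.inr (ℓ, j)) σ →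
      D.baseLabel e ≠ j := by
    rintro e ℓ j ⟨h1, h2⟩ ⟨h3, h4⟩ hj
    refine h4 (mem_biUnion (x := e) ?_ h2)
    exact ⟨h1.trans h3.symm, hj⟩
  by_cases h : ∃ e, D.base.Enabled e σ ∧ D.baseLabel e = i
  · obtain ⟨e, he, hi⟩ := h
    refine ⟨Sum.inl e, ⟨he, hi⟩, ?_⟩
    rintro (e' | ⟨ℓ, j⟩) ⟨h1, h2⟩
    · by_contra hne
      exact D.not_both_enabled e' e (fun h => hne (by rw [h])) (Eq.trans h2 hi.symm) σ ⟨h1, he⟩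
    · exact absurd (hi.trans h2.symm) (hres e ℓ j he h1)
  · refine ⟨Sum.inr (σ.1, i), ⟨⟨rfl, ?_⟩, rfl⟩, ?_⟩
    · intro hmem
      obtain ⟨e, ⟨h1, h2⟩, h3⟩ := mem_iUnion₂.1 hmem
      exact h ⟨e, ⟨h1, h3⟩, h2⟩
    · rintro (e' | ⟨ℓ, j⟩) ⟨h1, h2⟩
      · exact absurd ⟨e', h1, h2⟩ h
      · obtain ⟨rfl, -⟩ := h1
        obtain rfl : j = i := h2
        rfl

/-- The integrand of `prFrom` after a jump into `σ` with remaining times `R`. -/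
noncomputable def prElapse (τ : List (Fin m ⊕ (Fin n × Fin k))) (σ : HState n d)
    (R : Fin k → ℝ≥0) : ℝ≥0∞ :=
  D.prFrom (D.automaton.evolve σ (⨅ j, R j)) (fun i => R i - ⨅ j, R j) τ

lemma measurable_prElapse_of_prFrom {τ : List (Fin m ⊕ (Fin n × Fin k))}
    (h : Measurable (fun p : HState n d × (Fin k → ℝ≥0) => D.prFrom p.1 p.2 τ)) :
    Measurable (fun p : HState n d × (Fin k → ℝ≥0) => D.prElapse τ p.1 p.2) := by
  have h1 : Measurable (fun p : HState n d × (Fin k → ℝ≥0) => ⨅ j, p.2 j) :=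
    measurable_iInf_fin.comp measurable_snd
  refine h.comp ((D.measurable_evolve.comp (measurable_fst.prodMk h1)).prodMk ?_)
  exact measurable_pi_lambda _ fun j => ((measurable_pi_apply j).comp measurable_snd).sub h1

/-- The value of `prFrom` when the jump `e` is enabled and due. -/
noncomputable def prResample (τ : List (Fin m ⊕ (Fin n × Fin k))) (e : Fin m ⊕ (Fin n × Fin k))
    (σ : HState n d) (R : Fin k → ℝ≥0) : ℝ≥0∞ :=
  ∫⁻ y, D.prElapse τ (D.automaton.after e σ) (Function.update R (D.label e) y)
    ∂(D.dist (D.label e) (D.automaton.after e σ))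

lemma measurable_prElapse_update {τ : List (Fin m ⊕ (Fin n × Fin k))}
    (h : Measurable (fun p : HState n d × (Fin k → ℝ≥0) => D.prElapse τ p.1 p.2))
    (e : Fin m ⊕ (Fin n × Fin k)) :
    Measurable (fun p : (HState n d × (Fin k → ℝ≥0)) × ℝ≥0 =>
      D.prElapse τ (D.automaton.after e p.1.1) (Function.update p.1.2 (D.label e) p.2)) :=
  h.comp (((D.measurable_after e).comp measurable_fst.fst).prodMk
    ((measurable_update_pair _).comp (measurable_snd.prodMk measurable_fst.snd)))

lemma measurable_prResample {τ : List (Fin m ⊕ (Fin n × Fin k))}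
    (h : Measurable (fun p : HState n d × (Fin k → ℝ≥0) => D.prElapse τ p.1 p.2))
    (e : Fin m ⊕ (Fin n × Fin k)) :
    Measurable (fun p : HState n d × (Fin k → ℝ≥0) => D.prResample τ e p.1 p.2) :=
  (D.measurable_prElapse_update h e).lintegral_kernel_prod_right'
    (κ := (D.dist (D.label e)).comap (fun p : HState n d × (Fin k → ℝ≥0) => D.automaton.after e p.1)
      ((D.measurable_after e).comp measurable_fst))

open Classical in
lemma prFrom_cons (σ : HState n d) (R : Fin k → ℝ≥0) (e : Fin m ⊕ (Fin n × Fin k))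
    (τ : List (Fin m ⊕ (Fin n × Fin k))) :
    D.prFrom σ R (e :: τ) =
      if D.automaton.Enabled e σ ∧ R (D.label e) = 0 then D.prResample τ e σ R else 0 := rfl

lemma measurable_prFrom (τ : List (Fin m ⊕ (Fin n × Fin k))) :
    Measurable (fun p : HState n d × (Fin k → ℝ≥0) => D.prFrom p.1 p.2 τ) := by
  classical
  induction τ with
  | nil => exact measurable_const
  | cons e τ ih =>
    simp only [prFrom_cons]
    refine Measurable.ite ?_ (D.measurable_prResample (D.measurable_prElapse_of_prFrom ih) e)
      measurable_const
    exact (measurable_fst (D.measurableSet_enabled e)).inter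
      (measurableSet_eq_fun ((measurable_pi_apply _).comp measurable_snd) measurable_const)

lemma measurable_prElapse (τ : List (Fin m ⊕ (Fin n × Fin k))) :
    Measurable (fun p : HState n d × (Fin k → ℝ≥0) => D.prElapse τ p.1 p.2) :=
  D.measurable_prElapse_of_prFrom (D.measurable_prFrom τ)

end DecomposedHA

/-! ### Uniform delays -/

/-- The uniform law on an interval of length `10`. -/
noncomputable def uniformTen (a : ℝ≥0) : Measure ℝ≥0 :=
  (10 : ℝ≥0∞)⁻¹ • lebesgueNN.restrict (Ioo a (a + 10))

lemma uniformTen_ac (a : ℝ≥0) : uniformTen a ≪ lebesgueNN :=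
  Measure.smul_absolutelyContinuous.trans Measure.restrict_le_self.absolutelyContinuous

lemma lebesgueNN_Ioo (a b : ℝ≥0) : lebesgueNN (Ioo a b) = ENNReal.ofReal (b - a) := by
  rw [lebesgueNN_apply]
  have : ((↑) : ℝ≥0 → ℝ) '' (Ioo a b) = Ioo (a : ℝ) b := by
    ext x
    constructor
    · rintro ⟨y, ⟨h1, h2⟩, rfl⟩
      exact ⟨by exact_mod_cast h1, by exact_mod_cast h2⟩
    · rintro ⟨h1, h2⟩
      exact ⟨⟨x, a.2.trans h1.le⟩, ⟨h1, h2⟩, rfl⟩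
  rw [this, Real.volume_Ioo]

instance (a : ℝ≥0) : IsProbabilityMeasure (uniformTen a) := by
  refine ⟨?_⟩
  rw [uniformTen, Measure.smul_apply, Measure.restrict_apply_univ, lebesgueNN_Ioo]
  simp only [NNReal.coe_add, NNReal.coe_ofNat, add_sub_cancel_left, smul_eq_mul,
    ENNReal.ofReal_ofNat]
  exact ENNReal.inv_mul_cancel (by simp) (by simp)

namespace DecomposedHA

variable {n d m k : ℕ} (D : DecomposedHA n d m k)

/-! ### Laws given the memory -/

/-- A jointly measurable density of the `i`-th random variable. -/
noncomputable def density (i : Fin k) : HState n d → ℝ≥0 → ℝ≥0∞ :=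
  (exists_measurable_density (D.dist i) (D.dist_absolutelyContinuous i)).choose

lemma measurable_density (i : Fin k) :
    Measurable (fun p : HState n d × ℝ≥0 => D.density i p.1 p.2) :=
  (exists_measurable_density (D.dist i) (D.dist_absolutelyContinuous i)).choose_spec.1

lemma density_lt_top (i : Fin k) (s : HState n d) (r : ℝ≥0) : D.density i s r < ∞ :=
  (exists_measurable_density (D.dist i) (D.dist_absolutelyContinuous i)).choose_spec.2.1 s r

lemma dist_eq_withDensity (i : Fin k) (s : HState n d) :
    D.dist i s = lebesgueNN.withDensity (D.density i s) :=
  (exists_measurable_density (D.dist i) (D.dist_absolutelyContinuous i)).choose_spec.2.2 s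

/-- The probability that the `i`-th random variable exceeds its age. -/
noncomputable def survival (M : Memory n d k) (i : Fin k) : ℝ≥0∞ :=
  D.dist i (M i).1 (Ioi (M i).2)

/-- The joint density of the event that the `i`-th random variable expires at its present age and
the others later. -/
noncomputable def weight (M : Memory n d k) (i : Fin k) : ℝ≥0∞ :=
  D.density i (M i).1 (M i).2 * ∏ j ∈ Finset.univ.erase i, D.survival M j

/-- The density of the first expiration. -/
noncomputable def totalWeight (M : Memory n d k) : ℝ≥0∞ := ∑ i, D.weight M i

/-- The probability that all random variables exceed their ages. -/
noncomputable def mass (M : Memory n d k) : ℝ≥0∞ := ∏ j, D.survival M j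

/-- The memory after a delay without jump. -/
noncomputable def ageBy (M : Memory n d k) (t : ℝ≥0) : Memory n d k :=
  fun i => ((M i).1, (M i).2 + t)

/-- The law of the remaining times on the event that no random variable has expired. -/
noncomputable def remainingLaw (M : Memory n d k) : Measure (Fin k → ℝ≥0) :=
  Measure.pi fun i => tail (D.dist i (M i).1) (M i).2

lemma survival_le_one (M : Memory n d k) (i : Fin k) : D.survival M i ≤ 1 := prob_le_one

lemma mass_lt_top (M : Memory n d k) : D.mass M < ∞ :=
  ENNReal.prod_lt_top fun i _ => (D.survival_le_one M i).trans_lt ENNReal.one_lt_top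

lemma weight_lt_top (M : Memory n d k) (i : Fin k) : D.weight M i < ∞ :=
  ENNReal.mul_lt_top (D.density_lt_top _ _ _)
    (ENNReal.prod_lt_top fun i _ => (D.survival_le_one M i).trans_lt ENNReal.one_lt_top)

lemma totalWeight_lt_top (M : Memory n d k) : D.totalWeight M < ∞ :=
  ENNReal.sum_lt_top.2 fun i _ => D.weight_lt_top M i

lemma measurable_ageBy :
    Measurable (fun p : Memory n d k × ℝ≥0 => ageBy p.1 p.2) :=
  measurable_pi_lambda _ fun i =>
    (((measurable_pi_apply i).comp measurable_fst).fst).prodMk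
      ((((measurable_pi_apply i).comp measurable_fst).snd).add measurable_snd)

lemma measurable_survival (i : Fin k) : Measurable (fun M => D.survival M i) := by
  have h : Measurable (fun p : HState n d × ℝ≥0 => D.dist i p.1 (Ioi p.2)) :=
    Kernel.measurable_kernel_prodMk_left
      (κ := (D.dist i).comap (Prod.fst : HState n d × ℝ≥0 → HState n d) measurable_fst)
      (t := {q : (HState n d × ℝ≥0) × ℝ≥0 | q.1.2 < q.2})
      (measurableSet_lt measurable_fst.snd measurable_snd)
  exact h.comp (measurable_pi_apply i)

lemma measurable_mass : Measurable D.mass :=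
  Finset.measurable_fun_prod _ fun i _ => D.measurable_survival i

lemma measurable_weight (i : Fin k) : Measurable (fun M => D.weight M i) :=
  ((D.measurable_density i).comp (measurable_pi_apply i)).mul
    (Finset.measurable_fun_prod _ fun j _ => D.measurable_survival j)

lemma measurable_totalWeight : Measurable D.totalWeight :=
  Finset.measurable_fun_sum _ fun i _ => D.measurable_weight i

lemma tail_dist (i : Fin k) (s : HState n d) (r : ℝ≥0) :
    tail (D.dist i s) r = lebesgueNN.withDensity (fun t => D.density i s (r + t)) := by
  rw [dist_eq_withDensity, tail_withDensity (f := D.density i s)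
    ((D.measurable_density i).comp measurable_prodMk_left)]
  simp_rw [add_comm]

lemma measurable_density_add (i : Fin k) (s : HState n d) (r : ℝ≥0) :
    Measurable (fun t => D.density i s (r + t)) :=
  (D.measurable_density i).comp (measurable_const.prodMk (measurable_id.const_add r))

instance (i : Fin k) (s : HState n d) (r : ℝ≥0) : NullSingletonClass (tail (D.dist i s) r) :=
  measure_singleton_of_ac (tail_ac (D.dist_absolutelyContinuous i s) r)

lemma remainingLaw_univ (M : Memory n d k) : D.remainingLaw M univ = D.mass M := by
  simp only [remainingLaw, Measure.pi_univ, tail_univ, mass, survival]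

/-- The minimum equals `t` when some clock expires at its age plus `t` and the others later; ties
are null, so the densities of these alternatives add up to `totalWeight (ageBy M t)`. -/
lemma lintegral_remainingLaw_iInf (M : Memory n d k) {φ : ℝ≥0 → ℝ≥0∞} (hφ : Measurable φ) :
    ∫⁻ x, φ (⨅ j, x j) ∂(D.remainingLaw M) =
      ∫⁻ t, φ t * D.totalWeight (ageBy M t) ∂lebesgueNN := by
  have := D.nonempty_fin
  have hw : ∀ i, Measurable fun t => D.weight (ageBy M t) i := fun i =>
    (D.measurable_weight i).comp (measurable_ageBy.comp measurable_prodMk_left)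
  simp only [totalWeight, Finset.mul_sum]
  rw [remainingLaw, lintegral_pi_iInf _ hφ, lintegral_finsetSum (f := fun i t => φ t * D.weight (ageBy M t) i) _
    fun i _ => hφ.mul (hw i)]
  refine Finset.sum_congr rfl fun i _ => ?_
  have hp : Measurable fun t => ∏ j ∈ Finset.univ.erase i, D.survival (ageBy M t) j :=
    (Finset.measurable_fun_prod _ fun j _ => D.measurable_survival j).comp
      (measurable_ageBy.comp measurable_prodMk_left)
  simp only [← tail_univ, tail_tail]
  simp only [tail_univ]
  rw [D.tail_dist]
  refine (lintegral_withDensity_eq_lintegral_mul _ (D.measurable_density_add _ _ _)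
    (hφ.mul hp)).trans ?_
  refine lintegral_congr fun t => ?_
  simp only [Pi.mul_apply, weight, ageBy, survival]
  ring

open Classical in
/-- The law of the next delay given the memory. -/
noncomputable def delayKernel : Kernel (Memory n d k) ℝ≥0 :=
  Kernel.piecewise (s := D.mass ⁻¹' {0}ᶜ) (D.measurable_mass (measurableSet_singleton 0).compl)
    (Kernel.withDensity (Kernel.const _ lebesgueNN)
      fun M t => D.totalWeight (ageBy M t) / D.mass M)
    -- A default for memories of mass 0, where the conditional law is meaningless; any absolutely
    -- continuous probability law would serve.
    (Kernel.const _ (uniformTen 0))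

lemma delayKernel_apply {M : Memory n d k} (h : D.mass M ≠ 0) :
    D.delayKernel M =
      lebesgueNN.withDensity (fun t => D.totalWeight (ageBy M t) / D.mass M) := by
  classical
  rw [delayKernel, Kernel.piecewise_apply, if_pos (by exact h), Kernel.withDensity_apply,
    Kernel.const_apply]
  exact (D.measurable_totalWeight.comp measurable_ageBy).div (D.measurable_mass.comp measurable_fst)

lemma delayKernel_apply_of_mass_eq_zero {M : Memory n d k} (h : D.mass M = 0) :
    D.delayKernel M = uniformTen 0 := by
  classical
  rw [delayKernel, Kernel.piecewise_apply, if_neg (by simpa using h), Kernel.const_apply]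

lemma measurable_totalWeight_ageBy (M : Memory n d k) :
    Measurable (fun t => D.totalWeight (ageBy M t)) :=
  D.measurable_totalWeight.comp (measurable_ageBy.comp measurable_prodMk_left)

lemma lintegral_delayKernel {M : Memory n d k} (h : D.mass M ≠ 0) {φ : ℝ≥0 → ℝ≥0∞}
    (hφ : Measurable φ) :
    D.mass M * ∫⁻ t, φ t ∂(D.delayKernel M) =
      ∫⁻ t, φ t * D.totalWeight (ageBy M t) ∂lebesgueNN := by
  have hm := D.measurable_totalWeight_ageBy M
  rw [D.delayKernel_apply h, lintegral_withDensity_eq_lintegral_mul _ (hm.div_const _) hφ,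
    ← lintegral_const_mul _ ((hm.div_const _).mul hφ)]
  refine lintegral_congr fun t => ?_
  rw [Pi.mul_apply, ← mul_assoc, ENNReal.mul_div_cancel h (D.mass_lt_top M).ne, mul_comm]

lemma mass_mul_delayKernel {M : Memory n d k} (h : D.mass M ≠ 0) {s : Set ℝ≥0}
    (hs : MeasurableSet s) :
    D.mass M * D.delayKernel M s = D.remainingLaw M ((fun x => ⨅ j, x j) ⁻¹' s) := by
  rw [← lintegral_indicator_one hs, D.lintegral_delayKernel h (measurable_one.indicator hs),
    ← D.lintegral_remainingLaw_iInf M (measurable_one.indicator hs),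
    ← lintegral_indicator_one (measurable_iInf_fin hs)]
  rfl

instance : IsMarkovKernel D.delayKernel := by
  refine ⟨fun M => ⟨?_⟩⟩
  by_cases h : D.mass M = 0
  · rw [D.delayKernel_apply_of_mass_eq_zero h, measure_univ]
  · have := D.mass_mul_delayKernel h .univ
    rw [preimage_univ, remainingLaw_univ] at this
    exact (ENNReal.mul_right_inj h (D.mass_lt_top M).ne).1 (by rw [this, mul_one])

lemma delayKernel_ac (M : Memory n d k) : D.delayKernel M ≪ lebesgueNN := by
  by_cases h : D.mass M = 0
  · rw [D.delayKernel_apply_of_mass_eq_zero h]; exact uniformTen_ac 0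
  · rw [D.delayKernel_apply h]; exact withDensity_absolutelyContinuous _ _

open Classical in
/-- The conditional probability that the `i`-th random variable expires, given that one does. -/
noncomputable def expiryProb (M : Memory n d k) (i : Fin k) : ℝ≥0∞ :=
  -- When no clock can be singled out, a default clock is chosen so that the probabilities still sum
  -- to 1.
  if D.totalWeight M = 0 then (if i = ⟨0, D.k_pos⟩ then 1 else 0)
  else D.weight M i / D.totalWeight M

lemma sum_expiryProb (M : Memory n d k) : ∑ i, D.expiryProb M i = 1 := by
  classical
  by_cases h : D.totalWeight M = 0
  · simp [expiryProb, h]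
  · simp only [expiryProb, h, if_false, div_eq_mul_inv, ← Finset.sum_mul]
    exact ENNReal.mul_inv_cancel h (D.totalWeight_lt_top M).ne

lemma measurable_expiryProb (i : Fin k) : Measurable (fun M => D.expiryProb M i) := by
  classical
  exact Measurable.ite (D.measurable_totalWeight (measurableSet_singleton 0)) measurable_const
    ((D.measurable_weight i).div D.measurable_totalWeight)

lemma expiryProb_mul_totalWeight (M : Memory n d k) (i : Fin k) :
    D.expiryProb M i * D.totalWeight M = D.weight M i := by
  classical
  by_cases h : D.totalWeight M = 0
  · have : D.weight M i = 0 := by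
      simpa using (Finset.sum_eq_zero_iff.1 h) i (Finset.mem_univ i)
    rw [h, this, mul_zero]
  · rw [expiryProb, if_neg h, ENNReal.div_mul_cancel h (D.totalWeight_lt_top M).ne]

lemma residual_eq (i : Fin k) (s : HState n d) (r : ℝ≥0) :
    D.residual i s r = (D.dist i s (Ioi r))⁻¹ • tail (D.dist i s) r := by
  rw [residual, tail, ProbabilityTheory.cond, Measure.map_smul]

lemma residual_zero (i : Fin k) (s : HState n d) : D.residual i s 0 = D.dist i s := by
  have h := tail_zero (D.dist_absolutelyContinuous i s)
  rw [residual_eq, ← tail_univ, h, measure_univ, inv_one, one_smul]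

/-- Each conditional law is the tail divided by its survival probability, and `mass M` is the
product of these divisors. -/
lemma pi_residual (M : Memory n d k) (h : D.mass M ≠ 0) :
    D.mass M • Measure.pi (fun i => D.residual i (M i).1 (M i).2) = D.remainingLaw M := by
  have hne : ∀ i, D.survival M i ≠ 0 := fun i hi =>
    h (Finset.prod_eq_zero (Finset.mem_univ i) hi)
  have hfin : ∀ i, IsFiniteMeasure (D.residual i (M i).1 (M i).2) := fun i => by
    rw [residual]; infer_instance
  refine (Measure.pi_eq fun s hs => ?_).symm
  rw [Measure.smul_apply, Measure.pi_pi, mass, smul_eq_mul, ← Finset.prod_mul_distrib]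
  refine Finset.prod_congr rfl fun i _ => ?_
  rw [residual_eq, Measure.smul_apply, smul_eq_mul, ← mul_assoc]
  change D.survival M i * (D.survival M i)⁻¹ * _ = _
  rw [ENNReal.mul_inv_cancel (hne i) ((D.survival_le_one M i).trans_lt ENNReal.one_lt_top).ne,
    one_mul]

/-- The law of the minimum of the remaining times. -/
lemma map_pi_residual (M : Memory n d k) (h : D.mass M ≠ 0) {s : Set ℝ≥0} (hs : MeasurableSet s) :
    (Measure.pi (fun i => D.residual i (M i).1 (M i).2)).map (fun x => ⨅ j, x j) s =
      D.delayKernel M s := by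
  rw [Measure.map_apply measurable_iInf_fin hs]
  refine (ENNReal.mul_right_inj h (D.mass_lt_top M).ne).1 ?_
  rw [D.mass_mul_delayKernel h hs, ← D.pi_residual M h]
  rfl

end DecomposedHA

namespace DecomposedHA

variable {n d m k : ℕ} (D : DecomposedHA n d m k)

/-! ### States that record the memory -/

/-- The auxiliary variables: for each random variable a code of the state in which it was sampled
and its age, and the last jump. -/
abbrev AuxVar (k : ℕ) : Type := Fin k ⊕ Fin k ⊕ Unit

/-- The number of variables including the auxiliary ones. -/
abbrev numVar (d k : ℕ) : ℕ := Fintype.card (Fin d ⊕ AuxVar k)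

/-- An enumeration of the variables. -/
noncomputable def varEquiv (d k : ℕ) : Fin d ⊕ AuxVar k ≃ Fin (numVar d k) := Fintype.equivFin _

/-- The number of jumps including the resampling jumps. -/
abbrev numJump (n m k : ℕ) : ℕ := Fintype.card (Fin m ⊕ (Fin n × Fin k))

/-- An enumeration of the jumps. -/
noncomputable def jumpEquiv (n m k : ℕ) : Fin m ⊕ (Fin n × Fin k) ≃ Fin (numJump n m k) :=
  Fintype.equivFin _

/-- The state with the value of the shared variables, the memory, and the last jump. -/
noncomputable def encode (σ : HState n d) (M : Memory n d k) (l : ℝ) : HState n (numVar d k) :=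
  (σ.1, fun v => Sum.elim σ.2 (Sum.elim (fun i => embeddingReal (HState n d) (M i).1)
    (Sum.elim (fun i => ((M i).2 : ℝ)) fun _ => l)) ((varEquiv d k).symm v))

/-- The values of the shared variables. -/
noncomputable def sharedPart (ν : Fin (numVar d k) → ℝ) : Fin d → ℝ :=
  fun i => ν (varEquiv d k (Sum.inl i))

lemma measurable_sharedPart : Measurable (sharedPart (d := d) (k := k)) :=
  measurable_pi_lambda _ fun _ => measurable_pi_apply _

lemma exists_measurable_stateDecode (D : DecomposedHA n d m k) :
    ∃ g : ℝ → HState n d, Measurable g ∧ g ∘ embeddingReal (HState n d) = id :=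
  (measurableEmbedding_embeddingReal (HState n d)).exists_measurable_extend measurable_id
    fun _ => ⟨D.automaton.init⟩

/-- A measurable inverse of the code of states. -/
noncomputable def stateDecode : ℝ → HState n d := D.exists_measurable_stateDecode.choose

lemma measurable_stateDecode : Measurable D.stateDecode :=
  D.exists_measurable_stateDecode.choose_spec.1

lemma stateDecode_embeddingReal (s : HState n d) :
    D.stateDecode (embeddingReal (HState n d) s) = s :=
  congrFun D.exists_measurable_stateDecode.choose_spec.2 s

/-- The recorded memory. -/
noncomputable def memoryPart (ν : Fin (numVar d k) → ℝ) : Memory n d k :=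
  fun i => (D.stateDecode (ν (varEquiv d k (Sum.inr (Sum.inl i)))),
    (ν (varEquiv d k (Sum.inr (Sum.inr (Sum.inl i))))).toNNReal)

lemma measurable_memoryPart : Measurable D.memoryPart :=
  measurable_pi_lambda _ fun _ =>
    (D.measurable_stateDecode.comp (measurable_pi_apply _)).prodMk
      (measurable_real_toNNReal.comp (measurable_pi_apply _))

lemma sharedPart_encode (σ : HState n d) (M : Memory n d k) (l : ℝ) :
    sharedPart (encode σ M l).2 = σ.2 := by
  ext i; simp [sharedPart, encode]

lemma memoryPart_encode (σ : HState n d) (M : Memory n d k) (l : ℝ) :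
    D.memoryPart (encode σ M l).2 = M := by
  ext i : 1
  simp [memoryPart, encode, stateDecode_embeddingReal]

lemma measurable_encode (l : ℝ) :
    Measurable (fun p : HState n d × Memory n d k => encode p.1 p.2 l) := by
  refine (measurable_fst.fst).prodMk (measurable_pi_lambda _ fun v => ?_)
  obtain ⟨w, rfl⟩ := (varEquiv d k).surjective v
  simp only [Equiv.symm_apply_apply]
  rcases w with i | i | i | i
  · exact (measurable_pi_apply i).comp measurable_fst.snd
  · exact (measurableEmbedding_embeddingReal _).measurable.comp
      ((measurable_pi_apply i).comp measurable_snd).fst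
  · exact measurable_coe_nnreal_real.comp ((measurable_pi_apply i).comp measurable_snd).snd
  · exact measurable_const

lemma measurable_updateMemory (t : ℝ≥0) (e : Fin m ⊕ (Fin n × Fin k)) :
    Measurable (fun p : Memory n d k × HState n d => D.updateMemory p.1 t e p.2) := by
  refine measurable_pi_lambda _ fun i => ?_
  by_cases h : i = D.label e
  · subst h
    simpa [updateMemory] using measurable_snd.prodMk measurable_const
  · simp only [updateMemory, Function.update_of_ne h]
    exact (((measurable_pi_apply i).comp measurable_fst).fst).prodMk
      ((((measurable_pi_apply i).comp measurable_fst).snd).add_const t)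

/-- In the composed automaton the flow has already aged the clocks when the jump occurs, so its
reset updates the memory with delay 0. -/
lemma updateMemory_ageBy (M : Memory n d k) (t : ℝ≥0) (e : Fin m ⊕ (Fin n × Fin k))
    (σ : HState n d) : D.updateMemory (ageBy M t) 0 e σ = D.updateMemory M t e σ := by
  simp [updateMemory, ageBy]

/-! ### The composed automaton -/

/-- The state entered by the jump `e` from the shared and auxiliary variables `ν`. -/
noncomputable def jumpTarget (e : Fin m ⊕ (Fin n × Fin k)) (ν : Fin (numVar d k) → ℝ) :
    HState n (numVar d k) :=
  let σ := D.automaton.after e (D.automaton.source e, sharedPart ν)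
  encode σ (D.updateMemory (D.memoryPart ν) 0 e σ) (jumpEquiv n m k e : ℕ)

lemma measurable_jumpTarget (e : Fin m ⊕ (Fin n × Fin k)) : Measurable (D.jumpTarget e) := by
  have h : Measurable fun ν : Fin (numVar d k) → ℝ =>
      D.automaton.after e (D.automaton.source e, sharedPart ν) :=
    (D.measurable_after e).comp (measurable_const.prodMk measurable_sharedPart)
  exact (measurable_encode _).comp
    (h.prodMk ((D.measurable_updateMemory 0 e).comp (D.measurable_memoryPart.prodMk h)))

/-- The rates of the auxiliary variables. -/
def auxRate : AuxVar k → ℝ := Sum.elim 0 (Sum.elim 1 0)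

/-- The automaton of the composed scheduling: all jumps of `D`, and memory variables. -/
noncomputable def composedBase :
    HybridAutomaton n (numVar d k) (Fin (numJump n m k)) where
  flow := fun ℓ => extendField (varEquiv d k) (D.automaton.flow ℓ) auxRate
  source j := D.automaton.source ((jumpEquiv n m k).symm j)
  guard j := {ν | sharedPart ν ∈ D.automaton.guard ((jumpEquiv n m k).symm j)}
  reset j ν := (D.jumpTarget ((jumpEquiv n m k).symm j) ν).2
  target j := D.automaton.target ((jumpEquiv n m k).symm j)
  init := encode D.automaton.init D.initMemory 0

lemma composedBase_wellPosed : D.composedBase.WellPosed where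
  existsUnique_timeStep ℓ _ t := existsUnique_timeStep_extendField _
    (fun ν => D.wellPosed.existsUnique_timeStep ℓ ν t) _ _
  measurable_evolve ℓ := measurable_evolveVal_extendField _
    (D.wellPosed.existsUnique_timeStep ℓ) (D.wellPosed.measurable_evolve ℓ) _
  measurableSet_guard _ := measurable_sharedPart (D.measurableSet_guard _)
  measurable_reset _ := (D.measurable_jumpTarget _).snd

/-- Every reset writes the index of its own jump into the last variable, so the resets differ even
if all other data of two jumps coincide. -/
lemma composedBase_jumpsDistinct : D.composedBase.JumpsDistinct := by
  intro j j' h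
  have h1 := congrFun (congrFun (congrArg (fun p => p.2.2.1) h) 0)
    (varEquiv d k (Sum.inr (Sum.inr (Sum.inr ()))))
  simpa [composedBase, jumpTarget, encode, Fin.ext_iff] using h1

lemma composedBase_evolve (σ : HState n d) (M : Memory n d k) (l : ℝ) (t : ℝ≥0) :
    D.composedBase.composedExtension.evolve (encode σ M l) t =
      encode (D.automaton.evolve σ t) (ageBy M t) l := by
  refine Prod.ext rfl ?_
  change evolveVal (extendField (varEquiv d k) (D.base.flow σ.1) auxRate) (encode σ M l).2 t = _
  rw [evolveVal_extendField _ fun ν => D.wellPosed.existsUnique_timeStep σ.1 ν t]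
  ext v
  obtain ⟨w, rfl⟩ := (varEquiv d k).surjective v
  rcases w with i | i | i | i
  · simp only [encode, HybridAutomaton.evolve, Equiv.symm_apply_apply, Sum.elim_inl]
    rfl
  all_goals simp [encode, auxRate, ageBy]

lemma composedBase_enabled_iff (e : Fin m ⊕ (Fin n × Fin k)) (σ : HState n (numVar d k)) :
    D.composedBase.composedExtension.Enabled (Sum.inl (jumpEquiv n m k e)) σ ↔
      D.automaton.Enabled e (σ.1, sharedPart σ.2) := by
  simp [HybridAutomaton.Enabled, HybridAutomaton.composedExtension, composedBase]

/-- There is at least one label, and each label has an enabled jump, possibly a resampling jump of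
`D`, which is a given jump here. Hence the guards of the given jumps leave no gap. -/
lemma composedBase_not_enabled_inr (ℓ : Fin n) (σ : HState n (numVar d k)) :
    ¬ D.composedBase.composedExtension.Enabled (Sum.inr ℓ) σ := by
  rintro ⟨h1, h2⟩
  obtain ⟨e, ⟨he, -⟩, -⟩ := D.existsUnique_enabled (σ.1, sharedPart σ.2) ⟨0, D.k_pos⟩
  have h := (D.composedBase_enabled_iff e σ).2 he
  exact h2 (mem_biUnion (x := jumpEquiv n m k e) (h.1.trans h1.symm) h.2)

lemma composedBase_enabled_encode (e : Fin m ⊕ (Fin n × Fin k)) (σ : HState n d)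
    (M : Memory n d k) (l : ℝ) :
    D.composedBase.composedExtension.Enabled (Sum.inl (jumpEquiv n m k e)) (encode σ M l) ↔
      D.automaton.Enabled e σ := by
  rw [composedBase_enabled_iff, sharedPart_encode]; rfl

lemma composedBase_after (e : Fin m ⊕ (Fin n × Fin k)) (σ : HState n d) (M : Memory n d k)
    (l : ℝ) :
    D.composedBase.composedExtension.after (Sum.inl (jumpEquiv n m k e)) (encode σ M l) =
      encode (D.automaton.after e σ) (D.updateMemory M 0 e (D.automaton.after e σ))
        (jumpEquiv n m k e : ℕ) := by
  refine Prod.ext ?_ ?_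
  · simp [HybridAutomaton.after, HybridAutomaton.composedExtension, composedBase, encode]
  · change (D.jumpTarget ((jumpEquiv n m k).symm (jumpEquiv n m k e)) (encode σ M l).2).2 = _
    rw [Equiv.symm_apply_apply, jumpTarget, sharedPart_encode, memoryPart_encode]
    rfl

open Classical in
/-- The probability of taking the jump `e`. -/
noncomputable def jumpProb (e : Fin m ⊕ (Fin n × Fin k)) (σ : HState n (numVar d k)) : ℝ≥0∞ :=
  if D.automaton.Enabled e (σ.1, sharedPart σ.2) then D.expiryProb (D.memoryPart σ.2) (D.label e)
  else 0

lemma measurable_jumpProb (e : Fin m ⊕ (Fin n × Fin k)) : Measurable (D.jumpProb e) := by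
  classical
  refine Measurable.ite ?_ ((D.measurable_expiryProb _).comp
    (D.measurable_memoryPart.comp measurable_snd)) measurable_const
  exact (measurable_fst.prodMk (measurable_sharedPart.comp measurable_snd))
    (D.measurableSet_enabled e)

/-- Grouped by label, exactly one jump of each group is enabled and carries the whole expiry
probability of that clock. -/
lemma sum_jumpProb (σ : HState n (numVar d k)) : ∑ e, D.jumpProb e σ = 1 := by
  classical
  rw [← D.sum_expiryProb (D.memoryPart σ.2), ← Finset.sum_fiberwise _ D.label]
  refine Finset.sum_congr rfl fun i _ => ?_
  obtain ⟨e, ⟨he, rfl⟩, hu⟩ := D.existsUnique_enabled (σ.1, sharedPart σ.2) i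
  rw [Finset.sum_eq_single e]
  · rw [jumpProb, if_pos he]
  · intro e' he' hne
    rw [jumpProb, if_neg]
    exact fun h => hne (hu e' ⟨h, by simpa using he'⟩)
  · simp

/-- The choice of the jump given the state. -/
noncomputable def choiceKernel :
    Kernel (HState n (numVar d k)) (Fin (numJump n m k) ⊕ Fin n) where
  toFun σ := ∑ e, D.jumpProb e σ • Measure.dirac (Sum.inl (jumpEquiv n m k e))
  measurable' := by
    refine Measure.measurable_of_measurable_coe _ fun s _ => ?_
    simp only [Measure.finsetSum_apply, Measure.smul_apply, smul_eq_mul]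
    exact Finset.measurable_fun_sum _ fun e _ => (D.measurable_jumpProb e).mul_const _

lemma choiceKernel_apply (σ : HState n (numVar d k)) (s : Set (Fin (numJump n m k) ⊕ Fin n)) :
    D.choiceKernel σ s =
      ∑ e, D.jumpProb e σ * s.indicator 1 (Sum.inl (jumpEquiv n m k e)) := by
  change (∑ e, D.jumpProb e σ • Measure.dirac (Sum.inl (jumpEquiv n m k e)) :
    Measure (Fin (numJump n m k) ⊕ Fin n)) s = _
  simp only [Measure.finsetSum_apply, Measure.smul_apply, smul_eq_mul]
  simp

lemma choiceKernel_singleton (σ : HState n (numVar d k)) (e : Fin m ⊕ (Fin n × Fin k)) :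
    D.choiceKernel σ {Sum.inl (jumpEquiv n m k e)} = D.jumpProb e σ := by
  rw [choiceKernel_apply, Finset.sum_eq_single e]
  · simp
  · intro e' _ hne
    simp [hne]
  · simp

/-- The composed scheduling of the decomposed scheduling `D`. -/
noncomputable def compose : ComposedHA n (numVar d k) (numJump n m k) where
  base := D.composedBase
  wellPosed := D.composedBase_wellPosed
  jumpsDistinct := D.composedBase_jumpsDistinct
  delay := D.delayKernel.comap (fun σ => D.memoryPart σ.2)
    (D.measurable_memoryPart.comp measurable_snd)
  isMarkovKernel_delay := inferInstance
  delay_absolutelyContinuous σ := D.delayKernel_ac _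
  choice := D.choiceKernel
  isMarkovKernel_choice := ⟨fun σ => ⟨by
    rw [choiceKernel_apply, ← D.sum_jumpProb σ]; simp only [indicator_univ, Pi.one_apply, mul_one]⟩⟩
  choice_eq_zero σ e h := by
    rcases e with j | ℓ
    · obtain ⟨e, rfl⟩ := (jumpEquiv n m k).surjective j
      rw [choiceKernel_singleton, jumpProb, if_neg]
      rwa [composedBase_enabled_iff] at h
    · simp [choiceKernel_apply]

lemma compose_delay (σ : HState n d) (M : Memory n d k) (l : ℝ) :
    D.compose.delay (encode σ M l) = D.delayKernel M := by
  change D.delayKernel (D.memoryPart (encode σ M l).2) = _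
  rw [memoryPart_encode]

open Classical in
lemma compose_choice (σ : HState n d) (M : Memory n d k) (l : ℝ) (e : Fin m ⊕ (Fin n × Fin k)) :
    D.compose.choice (encode σ M l) {Sum.inl (jumpEquiv n m k e)} =
      if D.automaton.Enabled e σ then D.expiryProb M (D.label e) else 0 := by
  change D.choiceKernel _ _ = _
  rw [choiceKernel_singleton, jumpProb, memoryPart_encode, sharedPart_encode]
  rfl

lemma compose_step (e : Fin m ⊕ (Fin n × Fin k)) (σ : HState n d) (M : Memory n d k) (l : ℝ)
    (t : ℝ≥0) :
    D.compose.automaton.after (Sum.inl (jumpEquiv n m k e))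
        (D.compose.automaton.evolve (encode σ M l) t) =
      encode (D.automaton.after e (D.automaton.evolve σ t))
        (D.updateMemory M t e (D.automaton.after e (D.automaton.evolve σ t)))
        (jumpEquiv n m k e : ℕ) := by
  change D.composedBase.composedExtension.after _
    (D.composedBase.composedExtension.evolve _ t) = _
  rw [composedBase_evolve, composedBase_after, updateMemory_ageBy]

lemma compose_enabled_step (e : Fin m ⊕ (Fin n × Fin k)) (σ : HState n d) (M : Memory n d k)
    (l : ℝ) (t : ℝ≥0) :
    D.compose.automaton.Enabled (Sum.inl (jumpEquiv n m k e))
        (D.compose.automaton.evolve (encode σ M l) t) ↔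
      D.automaton.Enabled e (D.automaton.evolve σ t) := by
  change D.composedBase.composedExtension.Enabled _
    (D.composedBase.composedExtension.evolve _ t) ↔ _
  rw [composedBase_evolve, composedBase_enabled_encode]

/-! ### Probabilities of traces -/

/-- A freshly sampled clock exceeds age 0 almost surely. What remains is the product of survivals
inside `weight`, which drives the induction in `mass_mul_pr_compose`. -/
lemma mass_updateMemory (M : Memory n d k) (t : ℝ≥0) (e : Fin m ⊕ (Fin n × Fin k))
    (σ : HState n d) :
    D.mass (D.updateMemory M t e σ) =
      ∏ j ∈ Finset.univ.erase (D.label e), D.survival (ageBy M t) j := by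
  rw [mass, ← Finset.mul_prod_erase _ _ (Finset.mem_univ (D.label e))]
  have h : D.survival (D.updateMemory M t e σ) (D.label e) = 1 := by
    rw [survival, ← tail_univ]
    simp [updateMemory, tail_zero (D.dist_absolutelyContinuous _ _)]
  rw [h, one_mul]
  refine Finset.prod_congr rfl fun j hj => ?_
  simp [survival, updateMemory, ageBy, Finset.ne_of_mem_erase hj]

lemma remainingLaw_updateMemory (M : Memory n d k) (t : ℝ≥0) (e : Fin m ⊕ (Fin n × Fin k))
    (σ : HState n d) :
    D.remainingLaw (D.updateMemory M t e σ) =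
      Measure.pi (Function.update (fun j => tail (D.dist j (M j).1) ((M j).2 + t)) (D.label e)
        (D.dist (D.label e) σ)) := by
  rw [remainingLaw]
  congr 1
  ext j : 1
  by_cases h : j = D.label e
  · subst h
    simp [updateMemory, tail_zero (D.dist_absolutelyContinuous _ _)]
  · simp [updateMemory, h]

/-- One step of the decomposed scheduling. -/
lemma lintegral_prElapse_cons (e : Fin m ⊕ (Fin n × Fin k)) (τ : List (Fin m ⊕ (Fin n × Fin k)))
    (σ : HState n d) (M : Memory n d k) :
    ∫⁻ x, D.prElapse (e :: τ) σ x ∂(D.remainingLaw M) =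
      ∫⁻ t in {t | D.automaton.Enabled e (D.automaton.evolve σ t)},
        D.density (D.label e) (M (D.label e)).1 ((M (D.label e)).2 + t) *
          ∫⁻ x, D.prElapse τ (D.automaton.after e (D.automaton.evolve σ t)) x
            ∂(D.remainingLaw (D.updateMemory M t e (D.automaton.after e (D.automaton.evolve σ t))))
        ∂lebesgueNN := by
  classical
  set i := D.label e with hi
  set S : Set ℝ≥0 := {t | D.automaton.Enabled e (D.automaton.evolve σ t)}
  have hσ : Measurable fun t => D.automaton.evolve σ t :=
    D.measurable_evolve.comp measurable_prodMk_left
  have hS : MeasurableSet S := hσ (D.measurableSet_enabled e)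
  have hR : Measurable (fun p : ℝ≥0 × (Fin k → ℝ≥0) =>
      D.prResample τ e (D.automaton.evolve σ p.1) p.2) :=
    (D.measurable_prResample (D.measurable_prElapse τ) e).comp
      ((hσ.comp measurable_fst).prodMk measurable_snd)
  have hΦ : Measurable (Function.uncurry fun (t : ℝ≥0) (R : Fin k → ℝ≥0) =>
      if t ∈ S then D.prResample τ e (D.automaton.evolve σ t) R else 0) :=
    Measurable.ite (measurable_fst hS) hR measurable_const
  have h1 : ∀ x : Fin k → ℝ≥0, D.prElapse (e :: τ) σ x =
      if x i = ⨅ j, x j then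
        (if (⨅ j, x j) ∈ S then
          D.prResample τ e (D.automaton.evolve σ (⨅ j, x j)) (fun j => x j - ⨅ j, x j) else 0)
      else 0 := fun x => by
    have : x (D.label e) - ⨅ j, x j = 0 ↔ x i = ⨅ j, x j := by
      rw [tsub_eq_zero_iff_le]
      exact ⟨fun h => le_antisymm h (iInf_fin_le x i), fun h => h.le⟩
    rw [prElapse, prFrom_cons]
    simp only [this]
    by_cases hx : x i = ⨅ j, x j <;>
      by_cases hen : D.automaton.Enabled e (D.automaton.evolve σ (⨅ j, x j)) <;>
      simp [hx, hen, S]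
  simp_rw [h1]
  rw [remainingLaw, lintegral_pi_argmin _ i hΦ]
  simp only [tail_tail]
  have h2 : ∀ t, ∫⁻ x, (if t ∈ S then D.prResample τ e (D.automaton.evolve σ t) x else 0)
      ∂(Measure.pi (Function.update (fun j => tail (D.dist j (M j).1) ((M j).2 + t)) i
        (Measure.dirac 0))) =
      S.indicator (fun t => ∫⁻ x, D.prElapse τ (D.automaton.after e (D.automaton.evolve σ t)) x
        ∂(D.remainingLaw (D.updateMemory M t e
          (D.automaton.after e (D.automaton.evolve σ t))))) t := fun t => by
    by_cases ht : t ∈ S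
    · have hG : Measurable fun x =>
          D.prElapse τ (D.automaton.after e (D.automaton.evolve σ t)) x :=
        (D.measurable_prElapse τ).comp measurable_prodMk_left
      have hfin := isFiniteMeasure_update (fun j => tail (D.dist j (M j).1) ((M j).2 + t))
        (Measure.dirac 0) i
      simp only [ht, if_true, indicator_of_mem, remainingLaw_updateMemory]
      rw [lintegral_pi_update _ _ _ hG, ← lintegral_lintegral_swap]
      · rfl
      · exact (hG.comp ((measurable_update_pair i).comp measurable_swap)).aemeasurable
    · simp [ht]
  simp_rw [h2]
  rw [D.tail_dist, lintegral_withDensity_eq_lintegral_mul_non_measurable _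
    (D.measurable_density_add _ _ _) (.of_forall fun t => D.density_lt_top _ _ _),
    ← lintegral_indicator hS]
  refine lintegral_congr fun t => ?_
  by_cases ht : t ∈ S <;> simp [ht]

/-- The decomposed scheduling, from the remaining times given the memory, and the composed
scheduling, from the state that records the memory, give each trace the same probability. -/
theorem mass_mul_pr_compose (τ : List (Fin m ⊕ (Fin n × Fin k))) (σ : HState n d)
    (M : Memory n d k) (l : ℝ) :
    D.mass M * D.compose.pr (encode σ M l) (τ.map fun e => Sum.inl (jumpEquiv n m k e)) =
      ∫⁻ x, D.prElapse τ σ x ∂(D.remainingLaw M) := by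
  classical
  induction τ generalizing σ M l with
  | nil =>
    simp only [List.map_nil, ComposedHA.pr, prElapse, prFrom, lintegral_const,
      remainingLaw_univ, mul_one, one_mul]
  | cons e τ ih =>
    -- For mass 0 the composed delay is only a default, but both sides vanish.
    by_cases h0 : D.mass M = 0
    · have : D.remainingLaw M = 0 := by
        rw [← Measure.measure_univ_eq_zero, remainingLaw_univ, h0]
      rw [h0, zero_mul, this, lintegral_zero_measure]
    set S : Set ℝ≥0 := {t | D.automaton.Enabled e (D.automaton.evolve σ t)}
    have hS : MeasurableSet S :=
      (D.measurable_evolve.comp measurable_prodMk_left) (D.measurableSet_enabled e)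
    have hev : Measurable fun t => D.compose.automaton.evolve (encode σ M l) t :=
      D.compose.measurable_evolve.comp measurable_prodMk_left
    have hφ : Measurable fun t => D.compose.choice (D.compose.automaton.evolve (encode σ M l) t)
          {Sum.inl (jumpEquiv n m k e)} *
        D.compose.pr (D.compose.automaton.after (Sum.inl (jumpEquiv n m k e))
          (D.compose.automaton.evolve (encode σ M l) t))
          (τ.map fun e => Sum.inl (jumpEquiv n m k e)) :=
      ((D.compose.choice.measurable_coe (measurableSet_singleton _)).comp hev).mul
        ((D.compose.measurable_pr _).comp ((D.compose.measurable_after _).comp hev))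
    rw [List.map_cons, ComposedHA.pr, lintegral_prElapse_cons]
    simp only [compose_enabled_step, compose_delay]
    rw [← lintegral_indicator hS, D.lintegral_delayKernel h0 (hφ.indicator hS),
      ← lintegral_indicator hS]
    refine lintegral_congr fun t => ?_
    by_cases ht : t ∈ S
    · have hen : D.automaton.Enabled e (D.automaton.evolve σ t) := ht
      have hc : D.compose.choice (D.compose.automaton.evolve (encode σ M l) t)
          {Sum.inl (jumpEquiv n m k e)} = D.expiryProb (ageBy M t) (D.label e) := by
        have : D.compose.automaton.evolve (encode σ M l) t =
            encode (D.automaton.evolve σ t) (ageBy M t) l := D.composedBase_evolve σ M l t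
        rw [this, compose_choice, if_pos hen]
      -- The density of the delay times the choice probability is `weight`, that is, the density of
      -- the expiring clock times the mass of the updated memory. That mass is the factor in the
      -- induction hypothesis.
      rw [indicator_of_mem ht, indicator_of_mem ht, hc, compose_step, ← ih, mass_updateMemory,
        mul_right_comm, expiryProb_mul_totalWeight, weight, mul_assoc]
      rfl
    · simp [ht]

end DecomposedHA

namespace DecomposedHA

variable {n d m k : ℕ} (D : DecomposedHA n d m k)

/-! ### Equivalence with the composed scheduling -/

/-- The identification of `D` with its composed scheduling. -/
noncomputable def matching : Matching D.automaton D.compose.automaton where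
  loc := id
  shared := d
  var₁ := Function.Embedding.refl _
  var₂ := ⟨fun i => varEquiv d k (Sum.inl i), fun i j h => by simpa using h⟩
  jump e := Sum.inl (jumpEquiv n m k e)
  source_eq e _ := congrArg D.automaton.source (Equiv.symm_apply_apply _ _)
  target_eq e _ := congrArg D.automaton.target (Equiv.symm_apply_apply _ _)
  guard_eq e _ := by
    refine ⟨D.automaton.guard e, fun _ => Iff.rfl, fun ν => ?_⟩
    change sharedPart ν ∈ D.automaton.guard ((jumpEquiv n m k).symm (jumpEquiv n m k e)) ↔ _
    rw [Equiv.symm_apply_apply]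
    rfl
  reset_eq e _ := by
    refine ⟨D.automaton.reset e, fun _ => rfl, fun ν => ?_⟩
    change sharedPart (D.jumpTarget ((jumpEquiv n m k).symm (jumpEquiv n m k e)) ν).2 = _
    rw [Equiv.symm_apply_apply, jumpTarget, sharedPart_encode]
    rfl

/-- The composed run records the memory exactly; the value of the last-jump variable is irrelevant
and therefore left existential. -/
lemma exists_run_compose (h : List (ℝ≥0 × (Fin m ⊕ (Fin n × Fin k)))) (σ : HState n d)
    (M : Memory n d k) (l : ℝ) :
    ∃ l', D.compose.automaton.run (encode σ M l) (D.matching.mapPath h) =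
      encode (D.automaton.run σ h) (D.memory σ M h) l' := by
  induction h generalizing σ M l with
  | nil => exact ⟨l, rfl⟩
  | cons p h ih =>
    obtain ⟨t, e⟩ := p
    obtain ⟨l', hl'⟩ := ih (D.automaton.after e (D.automaton.evolve σ t))
      (D.updateMemory M t e (D.automaton.after e (D.automaton.evolve σ t)))
      (jumpEquiv n m k e : ℕ)
    refine ⟨l', ?_⟩
    rw [← D.compose_step e σ M l t] at hl'
    exact hl'

lemma isPath_compose_iff (h : List (ℝ≥0 × (Fin m ⊕ (Fin n × Fin k)))) (σ : HState n d)
    (M : Memory n d k) (l : ℝ) :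
    D.compose.automaton.IsPath (encode σ M l) (D.matching.mapPath h) ↔
      D.automaton.IsPath σ h := by
  induction h generalizing σ M l with
  | nil => exact Iff.rfl
  | cons p h ih =>
    obtain ⟨t, e⟩ := p
    refine and_congr (D.compose_enabled_step e σ M l t) ?_
    rw [← ih _ _ (jumpEquiv n m k e : ℕ), ← D.compose_step e σ M l t]
    exact Iff.rfl

lemma exists_mapPath_of_isPath (h' : List (ℝ≥0 × (Fin (numJump n m k) ⊕ Fin n)))
    (σ : HState n (numVar d k)) (hp : D.compose.automaton.IsPath σ h') :
    ∃ h, D.matching.mapPath h = h' := by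
  induction h' generalizing σ with
  | nil => exact ⟨[], rfl⟩
  | cons p h' ih =>
    obtain ⟨t, j | ℓ⟩ := p
    · obtain ⟨h, rfl⟩ := ih _ hp.2
      obtain ⟨e, rfl⟩ := (jumpEquiv n m k).surjective j
      exact ⟨(t, e) :: h, rfl⟩
    · exact absurd hp.1 (D.composedBase_not_enabled_inr ℓ _)

lemma mass_initMemory : D.mass D.initMemory = 1 := by
  refine Finset.prod_eq_one fun i _ => ?_
  rw [survival, ← tail_univ, initMemory, tail_zero (D.dist_absolutelyContinuous _ _), measure_univ]

/-- After a jump the mass is a product of survival probabilities of the other clocks at the time of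
the jump, and `Possible` makes these positive. -/
lemma mass_memory_ne_zero (h : List (ℝ≥0 × (Fin m ⊕ (Fin n × Fin k)))) (σ : HState n d)
    (M : Memory n d k) (hM : D.mass M ≠ 0) (hp : D.Possible σ M h) :
    D.mass (D.memory σ M h) ≠ 0 := by
  induction h generalizing σ M with
  | nil => exact hM
  | cons p h ih =>
    obtain ⟨t, e⟩ := p
    refine ih _ _ ?_ hp.2
    rw [mass_updateMemory]
    exact Finset.prod_ne_zero_iff.2 fun j _ => (hp.1 j).ne'

lemma pr_compose_init (τ : List (Fin m ⊕ (Fin n × Fin k))) :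
    D.compose.pr D.compose.automaton.init (τ.map D.matching.jump) = D.pr D.automaton.init τ := by
  have h := D.mass_mul_pr_compose τ D.automaton.init D.initMemory 0
  have hl : D.remainingLaw D.initMemory = Measure.pi fun i => D.dist i D.automaton.init := by
    simp only [remainingLaw, initMemory, tail_zero (D.dist_absolutelyContinuous _ _)]
  rw [mass_initMemory, one_mul, hl] at h
  exact h

lemma matching_jump_injective : Function.Injective D.matching.jump :=
  Sum.inl_injective.comp (jumpEquiv n m k).injective

theorem prEquiv_compose : PrEquiv D D.compose D.matching where
  states h _ := by
    obtain ⟨l, hl⟩ := D.exists_run_compose h D.automaton.init D.initMemory 0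
    change D.matching.Agree _ (D.compose.automaton.run (encode D.automaton.init D.initMemory 0) _)
    rw [hl]
    exact ⟨rfl, sharedPart_encode _ _ _⟩
  traces τ := by
    constructor
    · rintro ⟨h', hp, rfl⟩
      obtain ⟨h, rfl⟩ := D.exists_mapPath_of_isPath h' _ hp
      exact ⟨h.map Prod.snd, ⟨h, (D.isPath_compose_iff h _ D.initMemory 0).1 hp, rfl⟩,
        by simp [Matching.mapPath]⟩
    · rintro ⟨τ₁, ⟨h, hp, rfl⟩, rfl⟩
      exact ⟨D.matching.mapPath h, (D.isPath_compose_iff h _ D.initMemory 0).2 hp,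
        by simp [Matching.mapPath]⟩
  prob τ hτ := by
    obtain ⟨h', hp, rfl⟩ := hτ
    obtain ⟨h, rfl⟩ := D.exists_mapPath_of_isPath h' _ hp
    have hmap : (D.matching.mapPath h).map Prod.snd = (h.map Prod.snd).map D.matching.jump := by
      simp [Matching.mapPath]
    -- Jumps are identified one-to-one, so the sum over preimages has one term.
    rw [hmap, pr_compose_init, tsum_eq_single ⟨h.map Prod.snd, rfl⟩]
    rintro ⟨τ, hτ⟩ hne
    exact absurd (Subtype.ext (D.matching_jump_injective.list_map hτ)) hne
  delays h _ hpos t := by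
    obtain ⟨l, hl⟩ := D.exists_run_compose h D.automaton.init D.initMemory 0
    change _ = D.compose.delay
      (D.compose.automaton.run (encode D.automaton.init D.initMemory 0) _) _
    rw [hl, compose_delay, delayAfter]
    refine D.map_pi_residual _ (D.mass_memory_ne_zero h _ _ ?_ hpos) measurableSet_Iic
    rw [mass_initMemory]
    exact one_ne_zero

/-! ### Consequences of a long delay -/

/-- The next delay is almost surely longer than `t` if and only if all remaining times are. -/
lemma map_pi_residual_Iic_eq_zero_iff (M : Memory n d k) (h : D.mass M ≠ 0) (t : ℝ≥0) :
    (Measure.pi (fun i => D.residual i (M i).1 (M i).2)).map (fun x => ⨅ j, x j) (Iic t) = 0 ↔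
      ∀ i, D.residual i (M i).1 (M i).2 (Iic t) = 0 := by
  have := D.nonempty_fin
  have hprob : ∀ i, IsProbabilityMeasure (D.residual i (M i).1 (M i).2) := fun i => by
    have hi : D.dist i (M i).1 (Ioi (M i).2) ≠ 0 :=
      Finset.prod_ne_zero_iff.1 h i (Finset.mem_univ i)
    have := cond_isProbabilityMeasure hi
    exact Measure.isProbabilityMeasure_map (measurable_sub_right _).aemeasurable
  -- The minimum is at most `t` exactly if some coordinate is, and a finite union is null exactly if
  -- each of its parts is.
  have hset : (fun x : Fin k → ℝ≥0 => ⨅ j, x j) ⁻¹' Iic t =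
      ⋃ i, Function.eval i ⁻¹' Iic t := by
    ext x
    simp only [mem_preimage, mem_Iic, mem_iUnion, Function.eval]
    constructor
    · intro hx
      obtain ⟨i, hi⟩ := exists_eq_ciInf_of_finite (f := x)
      exact ⟨i, hi.trans_le hx⟩
    · rintro ⟨i, hi⟩
      exact (iInf_fin_le x i).trans hi
  rw [Measure.map_apply measurable_iInf_fin measurableSet_Iic, hset, measure_iUnion_null_iff]
  refine forall_congr' fun i => ?_
  rw [(measurePreserving_eval _ i).measure_preimage measurableSet_Iic.nullMeasurableSet]

end DecomposedHA

/-! ### A composed scheduling that cannot be decomposed -/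

section Counterexample

/-- Viewing the single clock as an extension of the system without variables lets the results on
constant rates supply its well-posedness. -/
lemma clock_eq_extendField : (fun _ _ => 1 : (Fin 1 → ℝ) → (Fin 1 → ℝ)) =
    extendField (Equiv.emptySum (Fin 0) (Fin 1)) id (fun _ => 1) := by
  ext; simp [extendField]

lemma existsUnique_timeStep_fin_zero (ν : Fin 0 → ℝ) (t : ℝ≥0) : ∃! ν', TimeStep id ν t ν' :=
  ⟨ν, ⟨fun _ => ν, continuousOn_const, rfl, rfl, fun _ _ => hasDerivAt_pi.2 fun i => i.elim0⟩,
    fun _ _ => Subsingleton.elim _ _⟩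

/-- From the location `0`, the jumps `0` and `1` lead to the locations `1` and `2`. -/
def branchBase : HybridAutomaton 3 1 (Fin 2) where
  flow _ _ _ := 1
  source _ := 0
  guard _ := univ
  reset _ := id
  target := ![1, 2]
  init := (0, 0)

lemma branchBase_wellPosed : branchBase.WellPosed where
  existsUnique_timeStep _ ν t := by
    change ∃! ν', TimeStep (fun _ _ => 1) ν t ν'
    rw [clock_eq_extendField]
    exact existsUnique_timeStep_extendField _ (fun ν => existsUnique_timeStep_fin_zero ν t) _ _
  measurable_evolve _ := by
    change Measurable fun p : (Fin 1 → ℝ) × ℝ≥0 => evolveVal (fun _ _ => 1) p.1 p.2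
    rw [clock_eq_extendField]
    exact measurable_evolveVal_extendField _ existsUnique_timeStep_fin_zero
      (measurable_pi_lambda _ fun i => i.elim0) _
  measurableSet_guard _ := .univ
  measurable_reset _ := measurable_id

lemma branchBase_jumpsDistinct : branchBase.JumpsDistinct := by
  intro i j h
  have h1 : (![1, 2] : Fin 2 → Fin 3) i = ![1, 2] j := congrArg (fun p => p.2.2.2) h
  fin_cases i <;> fin_cases j <;> simp_all

lemma branchBase_enabled_inr {σ : HState 3 1} (h : σ.1 ≠ 0) :
    branchBase.composedExtension.Enabled (Sum.inr σ.1) σ := by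
  refine ⟨rfl, fun hmem => ?_⟩
  obtain ⟨e, he, -⟩ := mem_iUnion₂.1 hmem
  exact h (Eq.symm he)

/-- The law of the jump: `1/4` and `3/4` in the location `0`, and resampling elsewhere. -/
noncomputable def branchLaw (ℓ : Fin 3) : Measure (Fin 2 ⊕ Fin 3) :=
  if ℓ = 0 then (1 / 4 : ℝ≥0∞) • Measure.dirac (Sum.inl 0) + (3 / 4 : ℝ≥0∞) •
    Measure.dirac (Sum.inl 1) else Measure.dirac (Sum.inr ℓ)

instance (ℓ : Fin 3) : IsProbabilityMeasure (branchLaw ℓ) := by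
  unfold branchLaw
  split_ifs
  · refine ⟨?_⟩
    simp only [Measure.add_apply, Measure.smul_apply, measure_univ, smul_eq_mul, mul_one]
    rw [ENNReal.div_add_div_same]
    norm_num
    exact ENNReal.div_self (by simp) (by simp)
  · infer_instance

/-- The law of the delay: uniform on `(0, 10)` in the location `0`, on `(20, 30)` elsewhere. -/
noncomputable def branchDelay (ℓ : Fin 3) : Measure ℝ≥0 := uniformTen (if ℓ = 0 then 0 else 20)

instance (ℓ : Fin 3) : IsProbabilityMeasure (branchDelay ℓ) := by unfold branchDelay; infer_instance

/-- The initial delay is uniform on `(0, 10)`, one of two jumps follows, and the delay thereafter is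
at least `20`. -/
noncomputable def branchHA : ComposedHA 3 1 2 where
  base := branchBase
  wellPosed := branchBase_wellPosed
  jumpsDistinct := branchBase_jumpsDistinct
  delay := (Kernel.ofFunOfCountable branchDelay).comap Prod.fst measurable_fst
  isMarkovKernel_delay := ⟨fun σ => inferInstanceAs (IsProbabilityMeasure (branchDelay σ.1))⟩
  delay_absolutelyContinuous _ := uniformTen_ac _
  choice := (Kernel.ofFunOfCountable branchLaw).comap Prod.fst measurable_fst
  isMarkovKernel_choice := ⟨fun σ => inferInstanceAs (IsProbabilityMeasure (branchLaw σ.1))⟩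
  choice_eq_zero σ e h := by
    change branchLaw σ.1 {e} = 0
    by_cases h0 : σ.1 = 0
    · rcases e with e | ℓ
      · exact absurd ⟨h0.symm, mem_univ _⟩ h
      · simp [branchLaw, h0]
    · rw [branchLaw, if_neg h0, Measure.dirac_apply' _ (measurableSet_singleton _)]
      refine indicator_of_notMem (fun he => h ?_) _
      rw [← mem_singleton_iff.1 he]
      exact branchBase_enabled_inr h0

lemma branchHA_delay (σ : HState 3 1) : branchHA.delay σ = branchDelay σ.1 := rfl

lemma uniformTen_Iic_self (a : ℝ≥0) : uniformTen a (Iic a) = 0 := by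
  have : Iic a ∩ Ioo a (a + 10) = ∅ := by
    ext x; simp only [mem_inter_iff, mem_Iic, mem_Ioo, mem_empty_iff_false, iff_false]
    rintro ⟨h1, h2, -⟩; exact absurd h1 (not_le.2 h2)
  rw [uniformTen, Measure.smul_apply, Measure.restrict_apply measurableSet_Iic, this]
  simp

lemma uniformTen_zero_Iic (t : ℝ≥0) :
    uniformTen 0 (Iic t) = ((min (t / 10) 1 : ℝ≥0) : ℝ≥0∞) := by
  have h0 : NullSingletonClass lebesgueNN := ⟨lebesgueNN_singleton⟩
  have h1 : (Iic t ∩ Ioo 0 (0 + 10) : Set ℝ≥0) =ᵐ[lebesgueNN] Ioo 0 (min t 10) := by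
    have : (Ioo 0 (min t 10) : Set ℝ≥0) = Iio t ∩ Ioo 0 (0 + 10) := by
      ext x; simp only [zero_add, mem_Ioo, lt_min_iff, mem_inter_iff, mem_Iio]; tauto
    rw [this]
    exact Iio_ae_eq_Iic.symm.inter ae_eq_rfl
  rw [uniformTen, Measure.smul_apply, Measure.restrict_apply measurableSet_Iic,
    measure_congr h1, lebesgueNN_Ioo, NNReal.coe_zero, sub_zero, ENNReal.ofReal_coe_nnreal,
    smul_eq_mul]
  have : (min (t / 10) 1 : ℝ≥0) = 10⁻¹ * min t 10 := by
    rw [mul_min, inv_mul_cancel₀ (by norm_num), div_eq_inv_mul]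
  rw [this, ENNReal.coe_mul, ENNReal.coe_inv (by norm_num)]
  rfl

lemma branchHA_delay_init (t : ℝ≥0) :
    branchHA.delay branchHA.automaton.init (Iic t) = ((min (t / 10) 1 : ℝ≥0) : ℝ≥0∞) := by
  rw [branchHA_delay, branchDelay, if_pos (by rfl), uniformTen_zero_Iic]

lemma branchHA_choice_init (t : ℝ≥0) :
    branchHA.choice (branchHA.automaton.evolve branchHA.automaton.init t) {Sum.inl 0} = 1 / 4 ∧
      branchHA.choice (branchHA.automaton.evolve branchHA.automaton.init t) {Sum.inl 1} =
        3 / 4 := by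
  change branchLaw 0 _ = _ ∧ branchLaw 0 _ = _
  simp [branchLaw]

variable {n d m k : ℕ} (D : DecomposedHA n d m k) (M : Matching D.automaton branchHA.automaton)

/-- Equality of traces provides a live preimage of the jump `j`. Its guard is determined by the
shared variables and matches the full guard in `branchHA`, so it is full as well. -/
lemma exists_enabled_of_prEquiv (h : PrEquiv D branchHA M) (j : Fin 2) :
    ∃ f, M.jump f = Sum.inl j ∧
      ∀ t, D.automaton.Enabled f (D.automaton.evolve D.automaton.init t) := by
  have htr : branchHA.automaton.IsTrace branchHA.automaton.init [Sum.inl j] :=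
    ⟨[(0, Sum.inl j)], ⟨⟨rfl, mem_univ _⟩, trivial⟩, rfl⟩
  obtain ⟨τ, hτ, hmap⟩ := (h.traces _).1 htr
  obtain ⟨f, rfl, hf⟩ := List.map_eq_singleton_iff.1 hmap
  have hlive : D.automaton.Live f := ⟨[f], hτ, by simp⟩
  obtain ⟨p, hp, hpm⟩ := hτ
  obtain ⟨⟨t, _⟩, rfl, rfl⟩ := List.map_eq_singleton_iff.1 hpm
  refine ⟨_, hf, fun s => ⟨hp.1.1, ?_⟩⟩
  obtain ⟨g, hg₁, hg₂⟩ := M.guard_eq _ hlive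
  refine (hg₁ _).2 ?_
  set x := (D.automaton.evolve D.automaton.init s).2 ∘ M.var₁
  -- Any shared valuation extends to a valuation of `branchHA`, where the guard is everything.
  have hx : Function.extend M.var₂ x 0 ∘ M.var₂ = x := funext (M.var₂.injective.extend_apply x 0)
  rw [← hx]
  refine (hg₂ _).1 ?_
  rw [hf]
  exact mem_univ _

/-- The path with delay 0 followed by `f` ages no clock, so the clock `i`, not being resampled,
keeps its unconditioned initial law. The delay clause covers this path, and in `branchHA` the next
delay exceeds 20; hence so does each remaining time. -/
lemma dist_Iic_eq_zero_of_prEquiv (h : PrEquiv D branchHA M) (j : Fin 2)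
    {f : Fin m ⊕ (Fin n × Fin k)} (hj : M.jump f = Sum.inl j)
    (hf : D.automaton.Enabled f (D.automaton.evolve D.automaton.init 0)) {i : Fin k}
    (hi : i ≠ D.label f) : D.dist i D.automaton.init (Iic 20) = 0 := by
  have hpath : D.automaton.IsPath D.automaton.init [(0, f)] := ⟨hf, trivial⟩
  have hone : ∀ i, D.dist i D.automaton.init (Ioi 0) = 1 := fun i => by
    rw [← tail_univ, tail_zero (D.dist_absolutelyContinuous _ _), measure_univ]
  have hpos : D.Possible D.automaton.init D.initMemory [(0, f)] := by
    refine ⟨fun i => ?_, trivial⟩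
    simp [DecomposedHA.initMemory, hone]
  have hmass := D.mass_memory_ne_zero _ _ _ (by rw [D.mass_initMemory]; exact one_ne_zero) hpos
  have hd := h.delays _ hpath hpos 20
  have hloc : (branchHA.automaton.run branchHA.automaton.init (M.mapPath [(0, f)])).1 ≠ 0 := by
    change branchHA.automaton.target (M.jump f) ≠ 0
    rw [hj]
    change (![1, 2] : Fin 2 → Fin 3) j ≠ 0
    fin_cases j <;> simp
  rw [branchHA_delay, branchDelay, if_neg hloc, uniformTen_Iic_self] at hd
  have hr := (D.map_pi_residual_Iic_eq_zero_iff _ hmass 20).1 hd i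
  simpa [DecomposedHA.memory, DecomposedHA.updateMemory, hi, DecomposedHA.initMemory,
    DecomposedHA.residual_zero] using hr

theorem not_prEquiv_branchHA : ¬ PrEquiv D branchHA M := by
  intro h
  obtain ⟨f₀, hj₀, hf₀⟩ := exists_enabled_of_prEquiv D M h 0
  obtain ⟨f₁, hj₁, hf₁⟩ := exists_enabled_of_prEquiv D M h 1
  -- Both jumps are enabled in the state after delay 0, where each label has a unique enabled jump.
  have hlab : D.label f₀ ≠ D.label f₁ := fun hl => by
    have : f₀ = f₁ := (D.existsUnique_enabled _ (D.label f₁)).unique ⟨hf₀ 0, hl⟩ ⟨hf₁ 0, rfl⟩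
    rw [this, hj₁] at hj₀
    simp at hj₀
  -- The clock of `f₀` is handled by jumping with `f₁`, every other clock by jumping with `f₀`.
  have hall : ∀ i, D.dist i D.automaton.init (Iic 20) = 0 := fun i => by
    by_cases hi : i = D.label f₀
    · exact dist_Iic_eq_zero_of_prEquiv D M h 1 hj₁ (hf₁ 0) (hi ▸ hlab)
    · exact dist_Iic_eq_zero_of_prEquiv D M h 0 hj₀ (hf₀ 0) hi
  have hd := h.delays [] trivial trivial 20
  have hzero : D.delayAfter [] (Iic 20) = 0 :=
    (D.map_pi_residual_Iic_eq_zero_iff D.initMemory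
      (by rw [D.mass_initMemory]; exact one_ne_zero) 20).2 fun i => by
        simpa [DecomposedHA.initMemory, DecomposedHA.residual_zero] using hall i
  have hone := branchHA_delay_init 20
  rw [hzero] at hd
  have : (0 : ℝ≥0∞) = ((min (20 / 10) 1 : ℝ≥0) : ℝ≥0∞) := hd.trans hone
  norm_num at this

end Counterexample

theorem theorem1 :
    (∀ (n d m k : ℕ) (D : DecomposedHA n d m k),
      ∃ (d' m' : ℕ) (C : ComposedHA n d' m') (M : Matching D.automaton C.automaton),
        Function.Injective M.loc ∧ Function.Surjective M.var₁ ∧ Function.Injective M.jump ∧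
          PrEquiv D C M) ∧
    (∃ (n d m : ℕ) (C : ComposedHA n d m) (e₁ e₂ : Fin m), e₁ ≠ e₂ ∧
      (∀ t : ℝ≥0, C.delay C.automaton.init (Set.Iic t) = ((min (t / 10) 1 : ℝ≥0) : ℝ≥0∞)) ∧
      (∀ t : ℝ≥0, C.choice (C.automaton.evolve C.automaton.init t) {Sum.inl e₁} = 1 / 4 ∧
        C.choice (C.automaton.evolve C.automaton.init t) {Sum.inl e₂} = 3 / 4) ∧
      ∀ (n' d' m' k : ℕ) (D : DecomposedHA n' d' m' k)
        (M : Matching D.automaton C.automaton), ¬ PrEquiv D C M) := by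
  refine ⟨fun n d m k D => ⟨_, _, D.compose, D.matching, Function.injective_id,
    Function.surjective_id, D.matching_jump_injective, D.prEquiv_compose⟩, ?_⟩
  exact ⟨3, 1, 2, branchHA, 0, 1, by decide, branchHA_delay_init, branchHA_choice_init,
    fun _ _ _ _ D M => not_prEquiv_branchHA D M⟩
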